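/- **Model.** Let $n\ge 1$ be an integer and let $\rho\in(0,1)$. An $n\times n$ input-queued switch consists of $n^2$ queues $(i,j)$, $1\le i,j\le n$, and operates in discrete time slots $\tau=1,2,\dots$. Let $Q_{ij}(\tau)$ be the size of queue $(i,j)$ at the beginning of slot $\tau$; the switch starts empty, $Q_{ij}(1)=0$. A *schedule* is a matrix $\sigma\in\{0,1\}^{n\times n}$ all of whose row sums and column sums are at most $1$. In each slot $\tau$ a *scheduling policy* chooses a schedule $\sigma(\tau)$ as a function of the past history (queue sizes, schedules and arrivals of all earlier slots) and the current queue sizes; then, at the end of the slot, $a_{ij}(\tau)$ new packets arrive to queue $(i,j)$, so that $$Q_{ij}(\tau+1)=\max\{Q_{ij}(\tau)-\sigma_{ij}(\tau),0\}+a_{ij}(\tau).$$ The random variables $a_{ij}(\tau)$, over all $i,j,\tau$, are independent, and each is Bernoulli with mean $\rho/n$. **Theorem 1.** There is an absolute constant $c>0$ such that for every integer $n\ge 1$ and every $\rho\in(0,1)$ there exists a scheduling policy (which may depend on $n$ and $\rho$) under which, for every $\tau\in\{1,2,\dots\}$, $$\mathbb{E}\Big[\sum_{i,j=1}^n Q_{ij}(\tau)\Big]\;\le\;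 c\,n\,(1-\rho)^{-4/3}\,\log\Big(\max\Big\{n,\frac1{1-\rho}\Big\}\Big).$$ -/

import Mathlib

open MeasureTheory ProbabilityTheory

/-- A schedule of an `n × n` switch: `val i j ∈ {0, 1}` is the number of packets that can be served
from queue `(i, j)` in one time slot, and at most one queue is served from each row and from each
column. -/
structure SwitchSchedule (n : ℕ) where
  val : Fin n → Fin n → ℕ
  zero_or_one : ∀ i j, val i j = 0 ∨ val i j = 1
  row_le : ∀ i, ∑ j, val i j ≤ 1
  col_le : ∀ j, ∑ i, val i j ≤ 1

/-- Everything that can be observed in one time slot: the queue sizes at its beginning, the schedule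
applied in its middle, and the numbers of packets that arrive at its end. -/
structure SwitchRecord (n : ℕ) where
  queue : Fin n → Fin n → ℕ
  schedule : SwitchSchedule n
  arrivals : Fin n → Fin n → ℕ

/-- A scheduling policy chooses the schedule of a time slot as a function of the past history (the
records of all earlier slots, most recent first, so that the length of the list is the number of the
current slot) and of the current queue sizes. -/
structure SwitchPolicy (n : ℕ) where
  decide : List (SwitchRecord n) → (Fin n → Fin n → ℕ) → SwitchSchedule n

namespace SwitchPolicy

/-- The evolution of the switch under the policy `π`, when `a t i j` packets arrive to queue `(i, j)`
at the end of time slot `t = 0, 1, 2, …`: the history before slot `t`, and the queue sizes at the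
beginning of slot `t`. The switch starts empty. The truncated subtraction of natural numbers is the
positive part in `Q (t + 1) = (Q t - σ t)⁺ + a t`. -/
def state {n : ℕ} (π : SwitchPolicy n) (a : ℕ → Fin n → Fin n → ℕ) :
    ℕ → List (SwitchRecord n) × (Fin n → Fin n → ℕ)
  | 0 => ([], fun _ _ => 0)
  | t + 1 =>
    let h := (state π a t).1
    let q := (state π a t).2
    let σ := π.decide h q
    (⟨q, σ, a t⟩ :: h, fun i j => (q i j - σ.val i j) + a t i j)

/-- The queue sizes at the beginning of time slot `t`. -/
def queue {n : ℕ} (π : SwitchPolicy n) (a : ℕ → Fin n → Fin n → ℕ) (t : ℕ) : Fin n → Fin n → ℕ :=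
  (π.state a t).2

end SwitchPolicy

/-- The `n²` arrival streams are independent Bernoulli processes of rate `p`: the numbers `a t ω i j`
of packets arriving to queue `(i, j)` in slot `t` are jointly independent over all `t`, `i`, `j`, and
each of them is `1` with probability `p` and `0` with probability `1 - p`. -/
structure IsBernoulliArrivals {Ω : Type*} [MeasurableSpace Ω] (P : Measure Ω) {n : ℕ}
    (p : unitInterval) (a : ℕ → Ω → Fin n → Fin n → ℕ) : Prop where
  measurable : ∀ t i j, Measurable fun ω => a t ω i j
  law : ∀ t i j, P.map (fun ω => a t ω i j) = bernoulliMeasure 1 0 p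
  indep : iIndepFun (fun (k : ℕ × Fin n × Fin n) (ω : Ω) => a k.1 ω k.2.1 k.2.2) P

/-! Time is cut into frames of `s` slots and batches of `m` frames, with `T = m * s`. Put `N = max n
(1 / (1 - ρ))` and `L = log N`. The arrivals of a frame form a random bipartite multigraph of mean
degree `r = ρ s`. It has a `k`-factor with overwhelming probability once `r - k` is a large multiple
of `√(s L)`, and `k` slots of the next frame serve that factor.

An exact factor takes precisely `k` packets from every row and every column. Hence, unless some
frame lacks a factor, the residual packets of a batch have line sums equal to the line sums of all
its arrivals minus `m k`: the losses `r - k` of the frames become idle slots and are not wasted. If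
`T` is a large multiple of `L / (1 - ρ)²`, it is very unlikely that a line receives `T` or more
packets in a batch; otherwise the residual packets fit into the idle slots of the next batch
(`BatchParams.not_overflows`).

Per port, the waiting packets then amount to about `s + m (s - k)`, that is, `s + T √(L / s) + (1 -
ρ) T`. With `T ≈ L / (1 - ρ)²` the first two terms balance at `s ≈ L (1 - ρ)^(-4/3)`, which is the
claimed bound; the third is only `L / (1 - ρ)`.

The residual packets of an overflowing batch join a backlog that is served at one packet per batch.
An overflow adds at most `n² T`, a power of `N`, and has probability below a much higher negative
power of `N`, so the mean backlog is at most 1 (`integral_exp_backlogSize_le`).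

The existence of factors rests on a Hall-type criterion (`hasFactor_of_le`) and a union bound over
cuts (`measure_not_hasFactor_le`); the accounting of packets is `BatchParams.queue_policy_le`. -/

/-! ### Factors of bipartite multigraphs and decomposition into matchings. -/

/-- The bipartite multigraph with `G i j` edges between row `i` and column `j` has a `k`-factor. -/
def HasFactor {n : ℕ} (k : ℕ) (G : Fin n → Fin n → ℕ) : Prop :=
  ∃ F : Fin n → Fin n → ℕ, (∀ i j, F i j ≤ G i j) ∧ (∀ i, ∑ j, F i j = k) ∧ ∀ j, ∑ i, F i j = k

/-- Adjacency in the auxiliary bipartite graph (row copies and edges against edges and column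
copies) whose perfect matchings encode `k`-factors. -/
def factorRel {n : ℕ} (k : ℕ) (G : Fin n → Fin n → ℕ) :
    (Fin n × Fin k) ⊕ (Σ c : Fin n × Fin n, Fin (G c.1 c.2)) →
    (Σ c : Fin n × Fin n, Fin (G c.1 c.2)) ⊕ (Fin n × Fin k) → Prop
  | .inl x, .inl e => e.1.1 = x.1
  | .inl _, .inr _ => False
  | .inr e, .inl e' => e = e'
  | .inr e, .inr y => e.1.2 = y.1

theorem card_sigma_fin_filter {n : ℕ} (G : Fin n → Fin n → ℕ) (S T : Finset (Fin n)) :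
    (Finset.univ.filter fun e : Σ c : Fin n × Fin n, Fin (G c.1 c.2) =>
      e.1.1 ∈ S ∧ e.1.2 ∈ T).card = ∑ i ∈ S, ∑ j ∈ T, G i j := by
  classical
  have : (Finset.univ.filter fun e : Σ c : Fin n × Fin n, Fin (G c.1 c.2) =>
      e.1.1 ∈ S ∧ e.1.2 ∈ T) = (S ×ˢ T).sigma fun _ => Finset.univ := by
    ext e; simp
  rw [this, Finset.card_sigma, Finset.sum_product]
  simp

/-- Hall's condition. A left set with row set `S`, edge set `Y` and columns `J` of `Y` sees `Y`
itself, the edges from `S` to `Jᶜ` (disjoint from `Y`), and all `k` copies of each column of `J`.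
The hypothesis for `S` and `Jᶜ` is exactly what makes these numerous enough. -/
theorem exists_factorRel_injective {n : ℕ} (k : ℕ) (G : Fin n → Fin n → ℕ)
    (h : ∀ A B : Finset (Fin n), k * (A.card + B.card) ≤ ∑ i ∈ A, ∑ j ∈ B, G i j + k * n) :
    ∃ f, Function.Injective f ∧ ∀ x, factorRel k G x (f x) := by
  classical
  rw [← Fintype.all_card_le_filter_rel_iff_exists_injective]
  intro A
  set S : Finset (Fin n) := Finset.univ.filter fun i => ∃ p, Sum.inl (i, p) ∈ A with hS
  set Y : Finset (Σ c : Fin n × Fin n, Fin (G c.1 c.2)) :=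
    Finset.univ.filter fun e => Sum.inr e ∈ A with hY
  set J : Finset (Fin n) := Y.image fun e => e.1.2 with hJ
  have hA : A ⊆ (S ×ˢ (Finset.univ : Finset (Fin k))).disjSum Y := by
    rintro (⟨i, p⟩ | e) hx
    · simpa [hS] using ⟨p, hx⟩
    · simpa [hY] using hx
  have hA' : A.card ≤ S.card * k + Y.card := by
    have := Finset.card_le_card hA
    simpa [Finset.card_disjSum, Finset.card_product] using this
  set Z := Finset.univ.filter fun e : Σ c : Fin n × Fin n, Fin (G c.1 c.2) =>
      e.1.1 ∈ S ∧ e.1.2 ∈ Jᶜ with hZ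
  have hYZ : Disjoint Y Z := by
    rw [Finset.disjoint_left]
    intro e he hz
    simp only [hZ, Finset.mem_filter, Finset.mem_compl] at hz
    exact hz.2.2 (Finset.mem_image_of_mem _ he)
  have hsub : (Y ∪ Z).disjSum (J ×ˢ (Finset.univ : Finset (Fin k))) ⊆
      Finset.univ.filter fun b => ∃ a ∈ A, factorRel k G a b := by
    rintro (e | ⟨j, p⟩) hx
    · rw [Finset.inl_mem_disjSum, Finset.mem_union] at hx
      simp only [Finset.mem_filter, Finset.mem_univ, true_and]
      rcases hx with hx | hx
      · exact ⟨Sum.inr e, by simpa [hY] using hx, rfl⟩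
      · simp only [hZ, hS, Finset.mem_filter, Finset.mem_univ, true_and] at hx
        obtain ⟨⟨p, hp⟩, -⟩ := hx
        exact ⟨_, hp, rfl⟩
    · simp only [Finset.inr_mem_disjSum, Finset.mem_product, hJ, Finset.mem_image] at hx
      obtain ⟨⟨e, he, hej⟩, -⟩ := hx
      simp only [Finset.mem_filter, Finset.mem_univ, true_and]
      exact ⟨Sum.inr e, by simpa [hY] using he, hej⟩
  have hc := Finset.card_le_card hsub
  rw [Finset.card_disjSum, Finset.card_union_of_disjoint hYZ, Finset.card_product,
    Finset.card_univ, Fintype.card_fin, hZ, card_sigma_fin_filter] at hc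
  have h1 := h S Jᶜ
  have hJn : Jᶜ.card + J.card = n := by
    rw [Finset.card_compl, Fintype.card_fin]
    have := Finset.card_le_univ J
    rw [Fintype.card_fin] at this
    omega
  have h2 : k * n = k * Jᶜ.card + k * J.card := by rw [← mul_add, hJn]
  rw [h2, mul_add] at h1
  rw [mul_comm] at hA'
  rw [mul_comm J.card] at hc
  have h3 : A.card ≤ Y.card + ∑ i ∈ S, ∑ j ∈ Jᶜ, G i j + k * J.card := by omega
  convert h3.trans hc

/-- Each edge has a left and a right copy, and the factor consists of the edges whose copies are not
matched to each other. For such an edge the right copy is taken by a copy of its row and the left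
copy takes a copy of its column, so every line meets exactly `k` of them. -/
theorem hasFactor_of_le {n : ℕ} (k : ℕ) (G : Fin n → Fin n → ℕ)
    (h : ∀ A B : Finset (Fin n), k * (A.card + B.card) ≤ ∑ i ∈ A, ∑ j ∈ B, G i j + k * n) :
    HasFactor k G := by
  classical
  obtain ⟨f, hf, hr⟩ := exists_factorRel_injective k G h
  have hbij : Function.Bijective f := by
    rw [Fintype.bijective_iff_injective_and_card]
    refine ⟨hf, ?_⟩
    simp [add_comm]
  have hsurj := hbij.2
  let U : Finset (Σ c : Fin n × Fin n, Fin (G c.1 c.2)) :=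
    Finset.univ.filter fun e => f (Sum.inr e) ≠ Sum.inl e
  have hU : ∀ e, e ∈ U ↔ f (Sum.inr e) ≠ Sum.inl e := fun e => by simp [U]
  clear_value U
  refine ⟨fun i j => (U.filter fun e => e.1 = (i, j)).card, ?_, ?_, ?_⟩
  · intro i j
    have := card_sigma_fin_filter G {i} {j}
    simp only [Finset.sum_singleton, Finset.mem_singleton] at this
    rw [← this]
    apply Finset.card_le_card
    intro e he
    have := (Finset.mem_filter.1 he).2
    simp [this]
  · intro i
    have h1 : ∑ j, (U.filter fun e => e.1 = (i, j)).card = (U.filter fun e => e.1.1 = i).card := by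
      rw [Finset.card_eq_sum_card_fiberwise (f := fun e => e.1.2) (t := Finset.univ)
        (fun _ _ => Finset.mem_coe.2 (Finset.mem_univ _))]
      refine Finset.sum_congr rfl fun j _ => ?_
      rw [Finset.filter_filter]
      congr 1
      ext e
      simp only [Finset.mem_filter, Prod.ext_iff]
    rw [h1]
    have hg : ∀ p : Fin k, ∃ e, f (Sum.inl (i, p)) = Sum.inl e ∧ e.1.1 = i := by
      intro p
      have := hr (Sum.inl (i, p))
      rcases hfx : f (Sum.inl (i, p)) with e | y
      · rw [hfx] at this; exact ⟨e, rfl, this⟩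
      · rw [hfx] at this; exact this.elim
    choose g hg1 hg2 using hg
    symm
    rw [← Fintype.card_fin k, ← Finset.card_univ]
    refine Finset.card_bij (fun p _ => g p) ?_ ?_ ?_
    · intro p _
      simp only [Finset.mem_filter, hU, hg2, and_true]
      intro h'
      rw [← hg1 p] at h'
      simpa using hf h'
    · intro p _ q _ hpq
      have : f (Sum.inl (i, p)) = f (Sum.inl (i, q)) := by rw [hg1, hg1, hpq]
      simpa using hf this
    · intro e he
      simp only [Finset.mem_filter, hU] at he
      obtain ⟨x, hx⟩ := hsurj (Sum.inl e)
      have hrx := hr x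
      rw [hx] at hrx
      rcases x with ⟨i', p⟩ | e'
      · have hi : e.1.1 = i' := hrx
        have hi' : i' = i := hi ▸ he.2
        subst hi'
        refine ⟨p, Finset.mem_univ _, ?_⟩
        rw [hg1] at hx
        exact Sum.inl.inj hx
      · have : e' = e := hrx
        subst this
        exact (he.1 hx).elim
  · intro j
    have h1 : ∑ i, (U.filter fun e => e.1 = (i, j)).card = (U.filter fun e => e.1.2 = j).card := by
      rw [Finset.card_eq_sum_card_fiberwise (f := fun e => e.1.1) (t := Finset.univ)
        (fun _ _ => Finset.mem_coe.2 (Finset.mem_univ _))]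
      refine Finset.sum_congr rfl fun i _ => ?_
      rw [Finset.filter_filter]
      congr 1
      ext e
      simp only [Finset.mem_filter, Prod.ext_iff]
      tauto
    rw [h1]
    have hg : ∀ p : Fin k, ∃ e, f (Sum.inr e) = Sum.inr (j, p) ∧ e.1.2 = j := by
      intro p
      obtain ⟨x, hx⟩ := hsurj (Sum.inr (j, p))
      have hrx := hr x
      rw [hx] at hrx
      rcases x with x | e
      · exact hrx.elim
      · exact ⟨e, hx, hrx⟩
    choose g hg1 hg2 using hg
    symm
    rw [← Fintype.card_fin k, ← Finset.card_univ]
    refine Finset.card_bij (fun p _ => g p) ?_ ?_ ?_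
    · intro p _
      simp [hU, hg2, hg1]
    · intro p _ q _ hpq
      have := hg1 q
      rw [← hpq, hg1] at this
      simpa using this
    · intro e he
      simp only [Finset.mem_filter, hU] at he
      have hre := hr (Sum.inr e)
      rcases hfe : f (Sum.inr e) with e' | ⟨j', p⟩
      · rw [hfe] at hre
        have : e = e' := hre
        exact (he.1 (by rw [hfe, this])).elim
      · rw [hfe] at hre
        have hj : e.1.2 = j' := hre
        have hj' : j' = j := hj ▸ he.2
        subst hj'
        refine ⟨p, Finset.mem_univ _, ?_⟩
        have := hf ((hg1 p).trans hfe.symm)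
        exact Sum.inr.inj this

/-- A regular bipartite multigraph of positive degree has a perfect matching. -/
theorem hasFactor_one_of_regular {n D : ℕ} (hD : 1 ≤ D) (M : Fin n → Fin n → ℕ)
    (hr : ∀ i, ∑ j, M i j = D) (hc : ∀ j, ∑ i, M i j = D) : HasFactor 1 M := by
  classical
  refine hasFactor_of_le 1 M fun A B => ?_
  have h1 : ∑ i ∈ A, ∑ j ∈ B, M i j + ∑ i ∈ A, ∑ j ∈ Bᶜ, M i j = D * A.card := by
    rw [← Finset.sum_add_distrib]
    simp_rw [Finset.sum_add_sum_compl, hr]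
    simp [mul_comm]
  have h2 : ∑ i ∈ A, ∑ j ∈ Bᶜ, M i j ≤ D * Bᶜ.card := by
    rw [Finset.sum_comm]
    calc ∑ j ∈ Bᶜ, ∑ i ∈ A, M i j ≤ ∑ j ∈ Bᶜ, D := by
          refine Finset.sum_le_sum fun j _ => ?_
          rw [← hc j]
          exact Finset.sum_le_sum_of_subset (Finset.subset_univ _)
      _ = _ := by simp [mul_comm]
  have h3 : Bᶜ.card + B.card = n := by
    rw [Finset.card_compl, Fintype.card_fin]
    have := Finset.card_le_univ B
    rw [Fintype.card_fin] at this
    omega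
  rw [one_mul, one_mul]
  -- The edges between `A` and `B` number at least `D (|A| - |Bᶜ|)`, which is at least `|A| - |Bᶜ|`
  -- because `D ≥ 1`.
  by_cases hle : A.card ≤ Bᶜ.card
  · omega
  · obtain ⟨d, hd⟩ := Nat.exists_eq_add_of_lt (not_le.1 hle)
    have h4 : D * A.card = D * Bᶜ.card + D * (d + 1) := by rw [hd]; ring
    have h5 : d + 1 ≤ D * (d + 1) := Nat.le_mul_of_pos_left _ hD
    omega

/-- A bipartite multigraph of maximum degree at most `D` is contained in a `D`-regular one. -/
theorem exists_regular_ge {n D : ℕ} (M : Fin n → Fin n → ℕ)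
    (hr : ∀ i, ∑ j, M i j ≤ D) (hc : ∀ j, ∑ i, M i j ≤ D) :
    ∃ M' : Fin n → Fin n → ℕ, (∀ i j, M i j ≤ M' i j) ∧ (∀ i, ∑ j, M' i j = D) ∧
      ∀ j, ∑ i, M' i j = D := by
  classical
  induction hN : n * D - ∑ i, ∑ j, M i j using Nat.strong_induction_on generalizing M with
  | _ N ih =>
  have htot : ∑ i, ∑ j, M i j ≤ n * D := by
    calc ∑ i, ∑ j, M i j ≤ ∑ _i : Fin n, D := Finset.sum_le_sum fun i _ => hr i
      _ = _ := by simp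
  by_cases hall : ∀ i, ∑ j, M i j = D
  · refine ⟨M, fun _ _ => le_rfl, hall, fun j => ?_⟩
    by_contra hj
    have h1 : ∑ j, ∑ i, M i j < ∑ _j : Fin n, D :=
      Finset.sum_lt_sum (fun j _ => hc j) ⟨j, Finset.mem_univ _, lt_of_le_of_ne (hc j) hj⟩
    rw [Finset.sum_comm] at h1
    simp [hall] at h1
  · push Not at hall
    obtain ⟨i0, hi0⟩ := hall
    have hi0' : ∑ j, M i0 j < D := lt_of_le_of_ne (hr i0) hi0
    have htot' : ∑ i, ∑ j, M i j < n * D := by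
      calc ∑ i, ∑ j, M i j < ∑ _i : Fin n, D :=
            Finset.sum_lt_sum (fun i _ => hr i) ⟨i0, Finset.mem_univ _, hi0'⟩
        _ = _ := by simp
    have hex : ∃ j0, ∑ i, M i j0 < D := by
      by_contra hcon
      push Not at hcon
      have : n * D ≤ ∑ j, ∑ i, M i j := by
        calc n * D = ∑ _j : Fin n, D := by simp
          _ ≤ _ := Finset.sum_le_sum fun j _ => hcon j
      rw [Finset.sum_comm] at this
      omega
    obtain ⟨j0, hj0⟩ := hex
    -- A deficient row and a deficient column exist together, so one edge can be added between them.
    let M1 : Fin n → Fin n → ℕ := fun i j => M i j + if i = i0 ∧ j = j0 then 1 else 0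
    have hrow : ∀ i, ∑ j, M1 i j = ∑ j, M i j + if i = i0 then 1 else 0 := by
      intro i
      simp only [M1, Finset.sum_add_distrib, add_right_inj]
      by_cases h : i = i0 <;> simp [h]
    have hcol : ∀ j, ∑ i, M1 i j = ∑ i, M i j + if j = j0 then 1 else 0 := by
      intro j
      simp only [M1, Finset.sum_add_distrib, add_right_inj]
      by_cases h : j = j0 <;> simp [h]
    have htot1 : ∑ i, ∑ j, M1 i j = ∑ i, ∑ j, M i j + 1 := by
      simp [hrow, Finset.sum_add_distrib]
    obtain ⟨M', h1, h2, h3⟩ := ih (n * D - ∑ i, ∑ j, M1 i j) (by omega) M1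
      (fun i => by
        rw [hrow]
        split_ifs with h
        · subst h; omega
        · simpa using hr i)
      (fun j => by
        rw [hcol]
        split_ifs with h
        · subst h; omega
        · simpa using hc j) rfl
    exact ⟨M', fun i j => (Nat.le_add_right _ _).trans (h1 i j), h2, h3⟩

instance {n : ℕ} : Inhabited (SwitchSchedule n) :=
  ⟨⟨fun _ _ => 0, fun _ _ => Or.inl rfl, fun _ => by simp, fun _ => by simp⟩⟩

/-- A bipartite multigraph of maximum degree at most `D` splits into `D` matchings. -/
theorem exists_schedules {n D : ℕ} (M : Fin n → Fin n → ℕ)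
    (hr : ∀ i, ∑ j, M i j ≤ D) (hc : ∀ j, ∑ i, M i j ≤ D) :
    ∃ σ : ℕ → SwitchSchedule n, ∀ i j, ∑ d ∈ Finset.range D, (σ d).val i j = M i j := by
  obtain ⟨M', hle, hr', hc'⟩ := exists_regular_ge M hr hc
  clear hr hc
  induction D generalizing M M' with
  | zero =>
    refine ⟨fun _ => default, fun i j => ?_⟩
    have h1 := hr' i
    have h2 : M' i j = 0 := by
      have := Finset.single_le_sum (f := fun j => M' i j) (fun _ _ => Nat.zero_le _)
        (Finset.mem_univ j)
      omega
    have := hle i j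
    simp
    omega
  | succ D ih =>
    obtain ⟨F, hF, hFr, hFc⟩ := hasFactor_one_of_regular (Nat.succ_pos D) M' hr' hc'
    have hF1 : ∀ i j, F i j ≤ 1 := fun i j => by
      rw [← hFr i]
      exact Finset.single_le_sum (f := fun j => F i j) (fun _ _ => Nat.zero_le _)
        (Finset.mem_univ j)
    -- The matching comes from the regular majorant `M'`, but the schedules must add up to `M`
    -- exactly; hence the minimum with `M`. Removing all of `F` from `M'` keeps it regular and above
    -- what is left of `M`.
    let σ0 : SwitchSchedule n := ⟨fun i j => min (M i j) (F i j), fun i j => by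
        have := hF1 i j
        omega,
      fun i => by
        rw [← hFr i]
        exact Finset.sum_le_sum fun j _ => min_le_right _ _,
      fun j => by
        rw [← hFc j]
        exact Finset.sum_le_sum fun j _ => min_le_right _ _⟩
    obtain ⟨σ, hσ⟩ := ih (fun i j => M i j - min (M i j) (F i j)) (fun i j => M' i j - F i j)
      (fun i j => by
        have := hle i j; have := hF i j; have := hF1 i j
        omega)
      (fun i => by
        rw [Finset.sum_tsub_distrib _ fun j _ => hF i j, hr' i, hFr i]; rfl)
      (fun j => by
        rw [Finset.sum_tsub_distrib _ fun i _ => hF i j, hc' j, hFc j]; rfl)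
    refine ⟨fun d => Nat.casesOn d σ0 σ, fun i j => ?_⟩
    rw [Finset.sum_range_succ']
    have := hσ i j
    change _ + min (M i j) (F i j) = _
    refine (congrArg (· + min (M i j) (F i j)) this).trans ?_
    have := min_le_left (M i j) (F i j)
    omega

/-! ### Policies driven by the past arrivals. -/

namespace SwitchPolicy

/-- The policy that applies the schedules `f a 0, f a 1, …` when the arrivals are `a`. -/
def ofArrivals {n : ℕ} (f : (ℕ → Fin n → Fin n → ℕ) → ℕ → SwitchSchedule n) : SwitchPolicy n :=
  -- The history lists the latest slot first, hence the reversal. Slots not yet observed read as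
  -- `0`, which is harmless for an `f` that depends only on the past.
  ⟨fun h _ => f (fun r => (h.reverse.map SwitchRecord.arrivals).getD r 0) h.length⟩

theorem map_arrivals_state {n : ℕ} (π : SwitchPolicy n) (a : ℕ → Fin n → Fin n → ℕ) (t : ℕ) :
    (π.state a t).1.reverse.map SwitchRecord.arrivals = (List.range t).map a := by
  induction t with
  | zero => simp [state]
  | succ t ih => simp [state, List.range_succ, ← ih]

theorem length_state {n : ℕ} (π : SwitchPolicy n) (a : ℕ → Fin n → Fin n → ℕ) (t : ℕ) :
    (π.state a t).1.length = t := by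
  simpa using congrArg List.length (map_arrivals_state π a t)

theorem queue_ofArrivals_succ {n : ℕ} {f : (ℕ → Fin n → Fin n → ℕ) → ℕ → SwitchSchedule n}
    (hf : ∀ a a' t, (∀ r < t, a r = a' r) → f a t = f a' t) (a : ℕ → Fin n → Fin n → ℕ)
    (t : ℕ) (i j : Fin n) :
    (ofArrivals f).queue a (t + 1) i j =
      ((ofArrivals f).queue a t i j - (f a t).val i j) + a t i j := by
  have h : (ofArrivals f).decide ((ofArrivals f).state a t).1 ((ofArrivals f).state a t).2 =
      f a t := by
    change f (fun r => (List.map SwitchRecord.arrivals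
      ((ofArrivals f).state a t).1.reverse).getD r 0) ((ofArrivals f).state a t).1.length = f a t
    rw [map_arrivals_state (ofArrivals f) a t, length_state (ofArrivals f) a t]
    refine hf _ _ _ fun r hr => ?_
    simp [List.getD, hr]
  simp only [queue, state]
  rw [h]

/-- If service never runs ahead of the packets present, the truncated subtraction never truncates,
and packets are conserved exactly. -/
theorem queue_ofArrivals_add {n : ℕ} {f : (ℕ → Fin n → Fin n → ℕ) → ℕ → SwitchSchedule n}
    (hf : ∀ a a' t, (∀ r < t, a r = a' r) → f a t = f a' t) (a : ℕ → Fin n → Fin n → ℕ)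
    (i j : Fin n)
    (hle : ∀ t, ∑ r ∈ Finset.range (t + 1), (f a r).val i j ≤ ∑ r ∈ Finset.range t, a r i j)
    (t : ℕ) :
    (ofArrivals f).queue a t i j + ∑ r ∈ Finset.range t, (f a r).val i j =
      ∑ r ∈ Finset.range t, a r i j := by
  induction t with
  | zero => simp [queue, state]
  | succ t ih =>
    have := hle t
    rw [Finset.sum_range_succ] at this
    rw [queue_ofArrivals_succ hf, Finset.sum_range_succ, Finset.sum_range_succ]
    omega

theorem queue_le_sum {n : ℕ} (π : SwitchPolicy n) (a : ℕ → Fin n → Fin n → ℕ) (t : ℕ)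
    (i j : Fin n) : π.queue a t i j ≤ ∑ r ∈ Finset.range t, a r i j := by
  induction t with
  | zero => simp [queue, state]
  | succ t ih =>
    rw [Finset.sum_range_succ]
    simp only [queue, state] at ih ⊢
    omega

theorem state_congr {n : ℕ} (π : SwitchPolicy n) {a a' : ℕ → Fin n → Fin n → ℕ} {t : ℕ}
    (h : ∀ r < t, a r = a' r) : π.state a t = π.state a' t := by
  induction t with
  | zero => rfl
  | succ t ih =>
    simp only [state]
    rw [ih fun r hr => h r (by omega), h t (by omega)]

end SwitchPolicy

/-! ### Sums over slots grouped into periods. -/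

theorem sum_range_mul_eq (f : ℕ → ℕ) (u T : ℕ) :
    ∑ t ∈ Finset.range (u * T), f t =
      ∑ v ∈ Finset.range u, ∑ r ∈ Finset.range T, f (v * T + r) := by
  induction u with
  | zero => simp
  | succ u ih => rw [Nat.succ_mul, Finset.sum_range_add, ih, Finset.sum_range_succ]

theorem sum_range_mul_div_mod (g : ℕ → ℕ → ℕ) (u T : ℕ) :
    ∑ t ∈ Finset.range (u * T), g (t / T) (t % T) =
      ∑ v ∈ Finset.range u, ∑ r ∈ Finset.range T, g v r := by
  rw [sum_range_mul_eq]
  refine Finset.sum_congr rfl fun v _ => Finset.sum_congr rfl fun r hr => ?_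
  have hr := Finset.mem_range.1 hr
  rw [mul_comm v T, Nat.mul_add_div (by omega), Nat.mul_add_mod, Nat.div_eq_of_lt hr,
    Nat.mod_eq_of_lt hr, add_zero]

theorem le_sum_range_div_mod (g : ℕ → ℕ → ℕ) (t T : ℕ) :
    ∑ v ∈ Finset.range (t / T), ∑ r ∈ Finset.range T, g v r ≤
      ∑ r ∈ Finset.range t, g (r / T) (r % T) := by
  rw [← sum_range_mul_div_mod]
  exact Finset.sum_le_sum_of_subset (Finset.range_mono (Nat.div_mul_le_self t T))

theorem sum_range_div_mod_le (g : ℕ → ℕ → ℕ) (t : ℕ) {T : ℕ} (hT : 0 < T) :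
    ∑ r ∈ Finset.range (t + 1), g (r / T) (r % T) ≤
      ∑ v ∈ Finset.range (t / T + 1), ∑ r ∈ Finset.range T, g v r := by
  rw [← sum_range_mul_div_mod]
  exact Finset.sum_le_sum_of_subset (Finset.range_mono (Nat.lt_div_mul_add hT |>.trans_eq
    (by ring)))

theorem sum_range_sum_Ico_mul (f : ℕ → ℕ) (u m : ℕ) :
    ∑ w ∈ Finset.range u, ∑ v ∈ Finset.Ico (w * m) ((w + 1) * m), f v =
      ∑ v ∈ Finset.range (u * m), f v := by
  rw [sum_range_mul_eq]
  refine Finset.sum_congr rfl fun v _ => ?_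
  rw [Finset.sum_Ico_eq_sum_range]
  congr 2
  rw [Nat.succ_mul, Nat.add_sub_cancel_left]

/-! ### Chosen factors, matchings and single packets. -/

open Classical in
/-- A `k`-factor of `G` if there is one, and `0` otherwise. -/
noncomputable def factor {n : ℕ} (k : ℕ) (G : Fin n → Fin n → ℕ) : Fin n → Fin n → ℕ :=
  if h : HasFactor k G then h.choose else 0

theorem factor_le {n : ℕ} (k : ℕ) (G : Fin n → Fin n → ℕ) (i j : Fin n) :
    factor k G i j ≤ G i j := by
  unfold factor
  split_ifs with h
  · exact h.choose_spec.1 i j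
  · exact Nat.zero_le _

theorem sum_factor_row_le {n : ℕ} (k : ℕ) (G : Fin n → Fin n → ℕ) (i : Fin n) :
    ∑ j, factor k G i j ≤ k := by
  unfold factor
  split_ifs with h
  · exact (h.choose_spec.2.1 i).le
  · simp

theorem sum_factor_col_le {n : ℕ} (k : ℕ) (G : Fin n → Fin n → ℕ) (j : Fin n) :
    ∑ i, factor k G i j ≤ k := by
  unfold factor
  split_ifs with h
  · exact (h.choose_spec.2.2 j).le
  · simp

theorem HasFactor.sum_factor_row {n k : ℕ} {G : Fin n → Fin n → ℕ} (h : HasFactor k G)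
    (i : Fin n) : ∑ j, factor k G i j = k := by
  rw [factor, dif_pos h]
  exact h.choose_spec.2.1 i

theorem HasFactor.sum_factor_col {n k : ℕ} {G : Fin n → Fin n → ℕ} (h : HasFactor k G)
    (j : Fin n) : ∑ i, factor k G i j = k := by
  rw [factor, dif_pos h]
  exact h.choose_spec.2.2 j

open Classical in
/-- `D` schedules that serve `M`, if `M` has row and column sums at most `D`. -/
noncomputable def matchings {n : ℕ} (D : ℕ) (M : Fin n → Fin n → ℕ) : ℕ → SwitchSchedule n :=
  if h : ∃ σ : ℕ → SwitchSchedule n, ∀ i j, ∑ d ∈ Finset.range D, (σ d).val i j = M i j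
  then h.choose else default

theorem sum_matchings {n D : ℕ} {M : Fin n → Fin n → ℕ}
    (hr : ∀ i, ∑ j, M i j ≤ D) (hc : ∀ j, ∑ i, M i j ≤ D) (i j : Fin n) :
    ∑ d ∈ Finset.range D, (matchings D M d).val i j = M i j := by
  have h := exists_schedules M hr hc
  rw [matchings, dif_pos h]
  exact h.choose_spec i j

/-- The schedule that serves queue `x` only. -/
def SwitchSchedule.single {n : ℕ} (x : Fin n × Fin n) : SwitchSchedule n where
  val i j := if i = x.1 ∧ j = x.2 then 1 else 0
  zero_or_one i j := by split_ifs <;> simp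
  row_le i := by by_cases h : i = x.1 <;> simp [h]
  col_le j := by by_cases h : j = x.2 <;> simp [h]

open Classical in
/-- A schedule that serves one packet of `M` if `M ≠ 0`. -/
noncomputable def onePacket {n : ℕ} (M : Fin n → Fin n → ℕ) : SwitchSchedule n :=
  if h : ∃ x : Fin n × Fin n, 0 < M x.1 x.2 then .single h.choose else default

theorem onePacket_le {n : ℕ} (M : Fin n → Fin n → ℕ) (i j : Fin n) :
    (onePacket M).val i j ≤ M i j := by
  unfold onePacket
  split_ifs with h
  · have := h.choose_spec
    simp only [SwitchSchedule.single]
    split_ifs with h'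
    · rw [h'.1, h'.2]; exact this
    · exact Nat.zero_le _
  · exact Nat.zero_le _

theorem sum_onePacket {n : ℕ} (M : Fin n → Fin n → ℕ) :
    ∑ i, ∑ j, (M i j - (onePacket M).val i j) = ∑ i, ∑ j, M i j - 1 := by
  have h1 : ∑ i, ∑ j, (M i j - (onePacket M).val i j) =
      ∑ i, ∑ j, M i j - ∑ i, ∑ j, (onePacket M).val i j := by
    rw [← Finset.sum_tsub_distrib _
      fun i _ => Finset.sum_le_sum fun j _ => onePacket_le M i j]
    refine Finset.sum_congr rfl fun i _ => ?_
    rw [← Finset.sum_tsub_distrib _ fun j _ => onePacket_le M i j]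
  rw [h1]
  unfold onePacket
  split_ifs with h
  · congr 1
    simp only [SwitchSchedule.single]
    rw [Finset.sum_eq_single h.choose.1, Finset.sum_eq_single h.choose.2]
    · simp
    · intro j _ hj; simp [hj]
    · simp
    · intro i _ hi; simp [hi]
    · simp
  · push Not at h
    have : ∀ i j, M i j = 0 := fun i j => Nat.le_zero.1 (h (i, j))
    simp [this]

/-- The sequence delayed by one step, starting with `0`. -/
def delay {α : Type*} [Zero α] (f : ℕ → α) : ℕ → α
  | 0 => 0
  | u + 1 => f u

theorem sum_range_succ_delay (f : ℕ → ℕ) (u : ℕ) :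
    ∑ v ∈ Finset.range (u + 1), delay f v = ∑ v ∈ Finset.range u, f v := by
  rw [Finset.sum_range_succ']
  simp [delay]

theorem delay_apply {n : ℕ} (f : ℕ → Fin n → Fin n → ℕ) (u : ℕ) (i j : Fin n) :
    delay f u i j = delay (fun v => f v i j) u := by
  cases u <;> rfl

/-! ### The batching policy and its pathwise accounting. -/

/-- The parameters of the batching policy: time is cut into frames of `s` slots, and into batches of
`m` frames; `k` slots of every frame serve a `k`-factor of the arrivals of the previous frame. -/
structure BatchParams where
  k : ℕ
  s : ℕ
  m : ℕ
  k_lt : k < s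
  m_pos : 0 < m

namespace BatchParams

variable (b : BatchParams) {n : ℕ} (a : ℕ → Fin n → Fin n → ℕ)

/-- The number of slots of a batch. -/
def T : ℕ := b.m * b.s

/-- The number of slots of a batch that serve the residual packets of the previous batch. -/
def d : ℕ := b.m * (b.s - b.k) - 1

/-- The arrivals of frame `v`. -/
def frame (v : ℕ) : Fin n → Fin n → ℕ := fun i j =>
  ∑ t ∈ Finset.Ico (v * b.s) ((v + 1) * b.s), a t i j

/-- The packets of frame `v` that are served in the next frame. -/
noncomputable def regular (v : ℕ) : Fin n → Fin n → ℕ := factor b.k (b.frame a v)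

/-- The packets of batch `u` that are not served within one frame. -/
noncomputable def residual (u : ℕ) : Fin n → Fin n → ℕ := fun i j =>
  ∑ v ∈ Finset.Ico (u * b.m) ((u + 1) * b.m), (b.frame a v i j - b.regular a v i j)

/-- The residual packets of batch `u` cannot be served in `d` slots. -/
def Overflows (u : ℕ) : Prop :=
  ¬ ((∀ i, ∑ j, b.residual a u i j ≤ b.d) ∧ ∀ j, ∑ i, b.residual a u i j ≤ b.d)

open Classical in
/-- The residual packets of batch `u` that are served in the next batch. -/
noncomputable def kept (u : ℕ) : Fin n → Fin n → ℕ :=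
  if b.Overflows a u then 0 else b.residual a u

open Classical in
/-- The residual packets of batch `u` that join the backlog. -/
noncomputable def spilled (u : ℕ) : Fin n → Fin n → ℕ :=
  if b.Overflows a u then b.residual a u else 0

/-- The backlog at the beginning of batch `u`. -/
noncomputable def backlog : ℕ → Fin n → Fin n → ℕ
  | 0 => 0
  | u + 1 => fun i j => (backlog u i j - (onePacket (backlog u)).val i j) + b.spilled a u i j

/-- The schedule in idle slot `q` of batch `u`. -/
noncomputable def idleSchedule (u q : ℕ) : SwitchSchedule n :=
  -- A batch has `d + 1` idle slots; the last one is reserved for the backlog.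
  if q < b.d then matchings b.d (delay (b.kept a) u) q else onePacket (b.backlog a u)

/-- The schedule in slot `t`. -/
noncomputable def schedule (t : ℕ) : SwitchSchedule n :=
  if t % b.s < b.k then matchings b.k (delay (b.regular a) (t / b.s)) (t % b.s)
  -- The last argument numbers the idle slots of the batch consecutively, `s - k` of them in each
  -- frame.
  else b.idleSchedule a (t / b.T) (t % b.T / b.s * (b.s - b.k) + (t % b.T % b.s - b.k))

theorem s_pos : 0 < b.s := (Nat.zero_le _).trans_lt b.k_lt

theorem T_pos : 0 < b.T := Nat.mul_pos b.m_pos b.s_pos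

theorem d_add_one : b.d + 1 = b.m * (b.s - b.k) := by
  have := Nat.mul_pos b.m_pos (Nat.sub_pos_of_lt b.k_lt)
  unfold d
  omega

theorem kept_add_spilled (u : ℕ) (i j : Fin n) :
    b.kept a u i j + b.spilled a u i j = b.residual a u i j := by
  unfold kept spilled
  split_ifs <;> simp

theorem sum_kept_row_le (u : ℕ) (i : Fin n) : ∑ j, b.kept a u i j ≤ b.d := by
  unfold kept
  split_ifs with h
  · simp
  · exact (not_not.1 h).1 i

theorem sum_kept_col_le (u : ℕ) (j : Fin n) : ∑ i, b.kept a u i j ≤ b.d := by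
  unfold kept
  split_ifs with h
  · simp
  · exact (not_not.1 h).2 j

theorem sum_delay_kept_row_le (u : ℕ) (i : Fin n) : ∑ j, delay (b.kept a) u i j ≤ b.d := by
  cases u with
  | zero => simp [delay]
  | succ u => exact b.sum_kept_row_le a u i

theorem sum_delay_kept_col_le (u : ℕ) (j : Fin n) : ∑ i, delay (b.kept a) u i j ≤ b.d := by
  cases u with
  | zero => simp [delay]
  | succ u => exact b.sum_kept_col_le a u j

theorem sum_delay_regular_row_le (v : ℕ) (i : Fin n) : ∑ j, delay (b.regular a) v i j ≤ b.k := by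
  cases v with
  | zero => simp [delay]
  | succ v => exact sum_factor_row_le _ _ i

theorem sum_delay_regular_col_le (v : ℕ) (j : Fin n) : ∑ i, delay (b.regular a) v i j ≤ b.k := by
  cases v with
  | zero => simp [delay]
  | succ v => exact sum_factor_col_le _ _ j

theorem backlog_add_sum (u : ℕ) (i j : Fin n) :
    b.backlog a u i j + ∑ w ∈ Finset.range u, (onePacket (b.backlog a w)).val i j =
      ∑ w ∈ Finset.range u, b.spilled a w i j := by
  induction u with
  | zero => simp [backlog]
  | succ u ih =>
    rw [Finset.sum_range_succ, Finset.sum_range_succ]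
    simp only [backlog]
    have := onePacket_le (b.backlog a u) i j
    omega

/-- The part of the schedule in slot `r` of frame `v` that serves the previous frame. -/
noncomputable def regularService (i j : Fin n) (v r : ℕ) : ℕ :=
  if r < b.k then (matchings b.k (delay (b.regular a) v) r).val i j else 0

/-- The part of the schedule in slot `w` of batch `u` that serves older packets. -/
noncomputable def idleService (i j : Fin n) (u w : ℕ) : ℕ :=
  if w % b.s < b.k then 0
  else (b.idleSchedule a u (w / b.s * (b.s - b.k) + (w % b.s - b.k))).val i j

/-- Separates the part with frame period from the part with batch period, so that each can be summed
over its own periods. -/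
theorem schedule_val (t : ℕ) (i j : Fin n) :
    (b.schedule a t).val i j = b.regularService a i j (t / b.s) (t % b.s) +
      b.idleService a i j (t / b.T) (t % b.T) := by
  have : t % b.T % b.s = t % b.s := Nat.mod_mul_left_mod t b.m b.s
  unfold schedule regularService idleService
  rw [this]
  split_ifs <;> simp

theorem sum_regularService (i j : Fin n) (v : ℕ) :
    ∑ r ∈ Finset.range b.s, b.regularService a i j v r = delay (b.regular a) v i j := by
  obtain ⟨c, hc⟩ := Nat.exists_eq_add_of_lt b.k_lt
  rw [hc, add_assoc, Finset.sum_range_add, ← sum_matchings (b.sum_delay_regular_row_le a v)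
    (b.sum_delay_regular_col_le a v) i j]
  simp only [regularService]
  rw [Finset.sum_congr rfl fun r hr => if_pos (Finset.mem_range.1 hr)]
  simp

theorem sum_idleService (i j : Fin n) (u : ℕ) :
    ∑ w ∈ Finset.range b.T, b.idleService a i j u w =
      delay (b.kept a) u i j + (onePacket (b.backlog a u)).val i j := by
  have h1 : ∑ w ∈ Finset.range b.T, b.idleService a i j u w =
      ∑ q ∈ Finset.range (b.m * (b.s - b.k)), (b.idleSchedule a u q).val i j := by
    rw [sum_range_mul_eq]
    unfold T idleService
    rw [sum_range_mul_div_mod (fun l r => if r < b.k then 0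
      else (b.idleSchedule a u (l * (b.s - b.k) + (r - b.k))).val i j)]
    refine Finset.sum_congr rfl fun l _ => ?_
    have hs : b.s = b.k + (b.s - b.k) := by have := b.k_lt; omega
    rw [congrArg Finset.range hs, Finset.sum_range_add,
      Finset.sum_eq_zero fun r hr => if_pos (Finset.mem_range.1 hr), zero_add]
    simp
  rw [h1, ← b.d_add_one, Finset.sum_range_succ, ← sum_matchings (b.sum_delay_kept_row_le a u)
    (b.sum_delay_kept_col_le a u) i j]
  congr 1
  · refine Finset.sum_congr rfl fun q hq => ?_
    rw [idleSchedule, if_pos (Finset.mem_range.1 hq)]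
  · rw [idleSchedule, if_neg (lt_irrefl _)]

theorem regular_le (v : ℕ) (i j : Fin n) : b.regular a v i j ≤ b.frame a v i j := factor_le _ _ _ _

theorem div_T (t : ℕ) : t / b.T = t / b.s / b.m := by
  rw [T, mul_comm, Nat.div_div_eq_div_mul]

theorem sum_residual (u : ℕ) (i j : Fin n) :
    ∑ w ∈ Finset.range u, b.residual a w i j =
      ∑ v ∈ Finset.range (u * b.m), (b.frame a v i j - b.regular a v i j) :=
  sum_range_sum_Ico_mul (fun v => b.frame a v i j - b.regular a v i j) u b.m

theorem sum_frame (v : ℕ) (i j : Fin n) :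
    ∑ w ∈ Finset.range v, b.frame a w i j = ∑ t ∈ Finset.range (v * b.s), a t i j :=
  sum_range_sum_Ico_mul (fun t => a t i j) v b.s

theorem sum_regular_add (v : ℕ) (i j : Fin n) :
    ∑ w ∈ Finset.range v, b.regular a w i j +
      ∑ w ∈ Finset.range v, (b.frame a w i j - b.regular a w i j) =
      ∑ t ∈ Finset.range (v * b.s), a t i j := by
  rw [← sum_frame, ← Finset.sum_add_distrib]
  exact Finset.sum_congr rfl fun w _ => Nat.add_sub_cancel' (b.regular_le a w i j)

/-- Causality: even if the current frame and batch are counted in full, they serve only packets of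
earlier frames and batches, and the classes regular, kept and spilled are disjoint parts of the
arrivals. No service is therefore wasted. -/
theorem sum_schedule_le (t : ℕ) (i j : Fin n) :
    ∑ r ∈ Finset.range (t + 1), (b.schedule a r).val i j ≤ ∑ r ∈ Finset.range t, a r i j := by
  simp_rw [schedule_val]
  rw [Finset.sum_add_distrib]
  have h1 := sum_range_div_mod_le (b.regularService a i j) t b.s_pos
  have h2 := sum_range_div_mod_le (b.idleService a i j) t b.T_pos
  simp_rw [sum_regularService, delay_apply, sum_range_succ_delay] at h1
  simp_rw [sum_idleService, Finset.sum_add_distrib, delay_apply, sum_range_succ_delay] at h2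
  have h3 : ∑ w ∈ Finset.range (t / b.T + 1), (onePacket (b.backlog a w)).val i j ≤
      ∑ w ∈ Finset.range (t / b.T), b.spilled a w i j := by
    rw [← b.backlog_add_sum a, Finset.sum_range_succ, add_comm]
    exact Nat.add_le_add_right (onePacket_le _ _ _) _
  have h4 : ∑ w ∈ Finset.range (t / b.T), b.kept a w i j +
      ∑ w ∈ Finset.range (t / b.T), b.spilled a w i j =
      ∑ w ∈ Finset.range (t / b.T), b.residual a w i j := by
    rw [← Finset.sum_add_distrib]
    exact Finset.sum_congr rfl fun w _ => b.kept_add_spilled a w i j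
  have h5 : ∑ w ∈ Finset.range (t / b.T), b.residual a w i j ≤
      ∑ v ∈ Finset.range (t / b.s), (b.frame a v i j - b.regular a v i j) := by
    rw [sum_residual, div_T]
    exact Finset.sum_le_sum_of_subset (Finset.range_mono (Nat.div_mul_le_self _ _))
  have h6 := b.sum_regular_add a (t / b.s) i j
  have h7 : ∑ r ∈ Finset.range (t / b.s * b.s), a r i j ≤ ∑ r ∈ Finset.range t, a r i j :=
    Finset.sum_le_sum_of_subset (Finset.range_mono (Nat.div_mul_le_self _ _))
  omega

theorem frame_congr {a a' : ℕ → Fin n → Fin n → ℕ} {v : ℕ}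
    (h : ∀ t ∈ Finset.Ico (v * b.s) ((v + 1) * b.s), a t = a' t) : b.frame a v = b.frame a' v := by
  ext i j
  exact Finset.sum_congr rfl fun t ht => by rw [h t ht]

theorem residual_congr {a a' : ℕ → Fin n → Fin n → ℕ} {u : ℕ}
    (h : ∀ t ∈ Finset.Ico (u * b.T) ((u + 1) * b.T), a t = a' t) :
    b.residual a u = b.residual a' u := by
  ext i j
  refine Finset.sum_congr rfl fun v hv => ?_
  have : b.frame a v = b.frame a' v := by
    refine b.frame_congr fun t ht => h t ?_
    rw [Finset.mem_Ico] at hv ht ⊢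
    constructor
    · calc u * b.T = u * b.m * b.s := by rw [T, mul_assoc]
        _ ≤ v * b.s := Nat.mul_le_mul_right _ hv.1
        _ ≤ t := ht.1
    · calc t < (v + 1) * b.s := ht.2
        _ ≤ (u + 1) * b.m * b.s := Nat.mul_le_mul_right _ hv.2
        _ = _ := by rw [T, mul_assoc]
  rw [regular, regular, this]

theorem overflows_congr {a a' : ℕ → Fin n → Fin n → ℕ} {u : ℕ}
    (h : ∀ t ∈ Finset.Ico (u * b.T) ((u + 1) * b.T), a t = a' t) :
    b.Overflows a u ↔ b.Overflows a' u := by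
  rw [Overflows, Overflows, b.residual_congr h]

theorem kept_congr {a a' : ℕ → Fin n → Fin n → ℕ} {u : ℕ}
    (h : ∀ t ∈ Finset.Ico (u * b.T) ((u + 1) * b.T), a t = a' t) :
    b.kept a u = b.kept a' u := by
  have h1 := b.overflows_congr h
  by_cases h2 : b.Overflows a' u <;> simp [kept, h1, h2, b.residual_congr h]

theorem spilled_congr {a a' : ℕ → Fin n → Fin n → ℕ} {u : ℕ}
    (h : ∀ t ∈ Finset.Ico (u * b.T) ((u + 1) * b.T), a t = a' t) :
    b.spilled a u = b.spilled a' u := by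
  have h1 := b.overflows_congr h
  by_cases h2 : b.Overflows a' u <;> simp [spilled, h1, h2, b.residual_congr h]

theorem backlog_congr {a a' : ℕ → Fin n → Fin n → ℕ} {u : ℕ}
    (h : ∀ t ∈ Finset.range (u * b.T), a t = a' t) : b.backlog a u = b.backlog a' u := by
  induction u with
  | zero => rfl
  | succ u ih =>
    have h1 : b.spilled a u = b.spilled a' u :=
      b.spilled_congr fun t ht => h t (by
        simp only [Finset.mem_Ico, Finset.mem_range] at ht ⊢; omega)
    rw [backlog, backlog, ih fun t ht => h t (by
      simp only [Finset.mem_range] at ht ⊢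
      exact ht.trans_le (Nat.mul_le_mul_right _ (Nat.le_succ u))), h1]

theorem schedule_congr (a a' : ℕ → Fin n → Fin n → ℕ) (t : ℕ) (h : ∀ r < t, a r = a' r) :
    b.schedule a t = b.schedule a' t := by
  have h1 : delay (b.regular a) (t / b.s) = delay (b.regular a') (t / b.s) := by
    have hle := Nat.div_mul_le_self t b.s
    rcases hv : t / b.s with _ | v
    · rfl
    · rw [hv] at hle
      simp only [delay, regular]
      rw [b.frame_congr fun r hr => h r ((Finset.mem_Ico.1 hr).2.trans_le hle)]
  have hle := Nat.div_mul_le_self t b.T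
  have h2 : delay (b.kept a) (t / b.T) = delay (b.kept a') (t / b.T) := by
    rcases hv : t / b.T with _ | v
    · rfl
    · rw [hv] at hle
      exact (b.kept_congr fun r hr => h r ((Finset.mem_Ico.1 hr).2.trans_le hle))
  have h3 : b.backlog a (t / b.T) = b.backlog a' (t / b.T) :=
    b.backlog_congr fun r hr => h r ((Finset.mem_range.1 hr).trans_le hle)
  unfold schedule idleSchedule
  rw [h1, h2, h3]

/-- The batching policy with parameters `b`. -/
noncomputable def policy (n : ℕ) : SwitchPolicy n := SwitchPolicy.ofArrivals b.schedule

/-- A waiting packet belongs to the current frame, to the factor of the previous frame, to the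
residue of the finished frames of the current batch, to the kept residue of the previous batch, or
to the backlog. Everything older has been served. -/
theorem queue_policy_le (t : ℕ) (i j : Fin n) :
    (b.policy n).queue a t i j ≤ b.frame a (t / b.s) i j + delay (b.regular a) (t / b.s) i j +
      ∑ v ∈ Finset.Ico (t / b.T * b.m) (t / b.s), (b.frame a v i j - b.regular a v i j) +
      delay (b.kept a) (t / b.T) i j + b.backlog a (t / b.T) i j := by
  have h0 := SwitchPolicy.queue_ofArrivals_add b.schedule_congr a i j
    (fun t => b.sum_schedule_le a t i j) t
  simp_rw [schedule_val] at h0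
  rw [Finset.sum_add_distrib] at h0
  have h1 := le_sum_range_div_mod (b.regularService a i j) t b.s
  have h2 := le_sum_range_div_mod (b.idleService a i j) t b.T
  simp_rw [sum_regularService, delay_apply] at h1
  simp_rw [sum_idleService, Finset.sum_add_distrib, delay_apply] at h2
  have h1' := sum_range_succ_delay (fun v => b.regular a v i j) (t / b.s)
  have h2' := sum_range_succ_delay (fun v => b.kept a v i j) (t / b.T)
  rw [Finset.sum_range_succ] at h1' h2'
  have h3 := b.backlog_add_sum a (t / b.T) i j
  have h4 : ∑ w ∈ Finset.range (t / b.T), b.kept a w i j +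
      ∑ w ∈ Finset.range (t / b.T), b.spilled a w i j =
      ∑ w ∈ Finset.range (t / b.T), b.residual a w i j := by
    rw [← Finset.sum_add_distrib]
    exact Finset.sum_congr rfl fun w _ => b.kept_add_spilled a w i j
  have hle : t / b.T * b.m ≤ t / b.s := by
    rw [div_T]; exact Nat.div_mul_le_self _ _
  have h5 := Finset.sum_range_add_sum_Ico
    (fun v => b.frame a v i j - b.regular a v i j) hle
  rw [← sum_residual] at h5
  have h6 := b.sum_regular_add a (t / b.s) i j
  have h7 : ∑ r ∈ Finset.range t, a r i j ≤
      ∑ r ∈ Finset.range (t / b.s * b.s), a r i j + b.frame a (t / b.s) i j := by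
    rw [← sum_frame, ← Finset.sum_range_succ (fun w => b.frame a w i j), sum_frame]
    exact Finset.sum_le_sum_of_subset (Finset.range_mono
      ((Nat.lt_div_mul_add b.s_pos).le.trans_eq (by ring)))
  rw [delay_apply, delay_apply]
  unfold policy
  omega

end BatchParams

/-! ### Measurability, independence and Chernoff bounds for the arrivals. -/

theorem Real.exp_neg_le_quadratic {x : ℝ} (hx : 0 ≤ x) : Real.exp (-x) ≤ 1 - x + x ^ 2 / 2 := by
  have h1 := Real.quadratic_le_exp_of_nonneg hx
  have h2 : 0 < 1 + x + x ^ 2 / 2 := by positivity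
  rw [Real.exp_neg]
  refine (inv_anti₀ h2 h1).trans ?_
  rw [inv_le_iff_one_le_mul₀ h2]
  -- The product of the two quadratics is `1 + x ^ 4 / 4`.
  nlinarith [sq_nonneg (x ^ 2)]

/-- The arrivals in the slots of `J`, extended by `0`. -/
def extendArrivals {n : ℕ} (J : Finset ℕ)
    (x : (J ×ˢ (Finset.univ : Finset (Fin n × Fin n)) : Finset _) → ℕ) :
    ℕ → Fin n → Fin n → ℕ :=
  fun t i j => if h : (t, i, j) ∈ J ×ˢ (Finset.univ : Finset (Fin n × Fin n)) then x ⟨_, h⟩ else 0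

namespace IsBernoulliArrivals

variable {Ω : Type*} [MeasurableSpace Ω] {P : Measure Ω} {n : ℕ} {p : unitInterval}
  {a : ℕ → Ω → Fin n → Fin n → ℕ}

theorem eq_extendArrivals {β : Type*} {J : Finset ℕ}
    {g : (ℕ → Fin n → Fin n → ℕ) → β} (hg : ∀ c c', (∀ t ∈ J, c t = c' t) → g c = g c')
    (c : ℕ → Fin n → Fin n → ℕ) : g c = g (extendArrivals J fun x => c x.1.1 x.1.2.1 x.1.2.2) := by
  refine hg _ _ fun t ht => ?_
  ext i j
  simp [extendArrivals, ht]

/-- A function of finitely many slots factors through a countable discrete space, on which every map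
is measurable. The same factorization yields independence over disjoint sets of slots. -/
theorem measurable_of_dependsOn (h : IsBernoulliArrivals P p a) {β : Type*} [MeasurableSpace β]
    {J : Finset ℕ} {g : (ℕ → Fin n → Fin n → ℕ) → β}
    (hg : ∀ c c', (∀ t ∈ J, c t = c' t) → g c = g c') :
    Measurable fun ω => g fun t => a t ω := by
  have h1 : Measurable fun ω => fun x : (J ×ˢ (Finset.univ : Finset (Fin n × Fin n)) : Finset _) =>
      a x.1.1 ω x.1.2.1 x.1.2.2 := measurable_pi_lambda _ fun x => h.measurable _ _ _
  have h2 : Measurable fun x => g (extendArrivals J x) := Measurable.of_discrete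
  rw [funext fun ω => eq_extendArrivals hg fun t => a t ω]
  exact h2.comp h1

theorem indepFun_of_dependsOn (h : IsBernoulliArrivals P p a) {β γ : Type*} [MeasurableSpace β]
    [MeasurableSpace γ] {J K : Finset ℕ} (hJK : Disjoint J K)
    {f : (ℕ → Fin n → Fin n → ℕ) → β} (hf : ∀ c c', (∀ t ∈ J, c t = c' t) → f c = f c')
    {g : (ℕ → Fin n → Fin n → ℕ) → γ} (hg : ∀ c c', (∀ t ∈ K, c t = c' t) → g c = g c') :
    IndepFun (fun ω => f fun t => a t ω) (fun ω => g fun t => a t ω) P := by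
  have h0 := h.indep.indepFun_finset (J ×ˢ Finset.univ) (K ×ˢ Finset.univ)
    (Finset.disjoint_product.2 (Or.inl hJK)) fun x => h.measurable _ _ _
  have h2 : Measurable fun x => f (extendArrivals J x) := Measurable.of_discrete
  have h3 : Measurable fun x => g (extendArrivals K x) := Measurable.of_discrete
  rw [funext fun ω => eq_extendArrivals hf fun t => a t ω,
    funext fun ω => eq_extendArrivals hg fun t => a t ω]
  exact h0.comp h2 h3

theorem integrable_comp (h : IsBernoulliArrivals P p a) (f : ℕ → ℝ) (t : ℕ) (i j : Fin n) :
    Integrable (fun ω => f (a t ω i j)) P := by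
  have := integrable_bernoulliMeasure (1 : ℕ) 0 p f
  rw [← h.law t i j] at this
  exact this.comp_measurable (h.measurable t i j)

theorem integral_comp (h : IsBernoulliArrivals P p a) (f : ℕ → ℝ) (t : ℕ) (i j : Fin n) :
    ∫ ω, f (a t ω i j) ∂P = p * f 1 + (1 - p) * f 0 := by
  have := integral_bernoulliMeasure (1 : ℕ) 0 p f
  rw [← h.law t i j, integral_map (h.measurable t i j).aemeasurable
    (Measurable.of_discrete).aestronglyMeasurable] at this
  simpa using this

theorem integral_eq (h : IsBernoulliArrivals P p a) (t : ℕ) (i j : Fin n) :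
    ∫ ω, (a t ω i j : ℝ) ∂P = p := by
  simpa using h.integral_comp (fun x => (x : ℝ)) t i j

theorem ae_le_one (h : IsBernoulliArrivals P p a) : ∀ᵐ ω ∂P, ∀ t i j, a t ω i j ≤ 1 := by
  simp_rw [ae_all_iff]
  intro t i j
  have h1 : ∀ᵐ x ∂(P.map fun ω => a t ω i j), x ≤ 1 := by
    rw [h.law, ae_iff, bernoulliMeasure_apply_of_notMem_of_notMem]
    · simp
    · simp
    · simp
  exact ae_of_ae_map (h.measurable t i j).aemeasurable h1

theorem mgf_le (h : IsBernoulliArrivals P p a) (θ : ℝ) (t : ℕ) (i j : Fin n) :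
    mgf (fun ω => (a t ω i j : ℝ)) P θ ≤ Real.exp (p * (Real.exp θ - 1)) := by
  rw [mgf, h.integral_comp (fun x => Real.exp (θ * x))]
  refine le_trans (le_of_eq ?_) (Real.add_one_le_exp _)
  simp
  ring

theorem mgf_sum_le (h : IsBernoulliArrivals P p a) (θ : ℝ) (J : Finset (ℕ × Fin n × Fin n)) :
    mgf (fun ω => ∑ x ∈ J, (a x.1 ω x.2.1 x.2.2 : ℝ)) P θ ≤
      Real.exp (J.card * p * (Real.exp θ - 1)) := by
  have h1 := (h.indep.comp (fun _ x => (x : ℝ)) fun _ => Measurable.of_discrete).mgf_sum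
    (t := θ) (fun x => (Measurable.of_discrete (f := fun x : ℕ => (x : ℝ))).comp
      (h.measurable x.1 x.2.1 x.2.2)) J
  have h2 : (∑ x ∈ J, (fun x : ℕ => (x : ℝ)) ∘ fun ω => a x.1 ω x.2.1 x.2.2) =
      fun ω => ∑ x ∈ J, (a x.1 ω x.2.1 x.2.2 : ℝ) := by
    ext ω; simp
  rw [h2] at h1
  rw [h1]
  refine (Finset.prod_le_prod (fun _ _ => mgf_nonneg)
    fun x _ => h.mgf_le θ x.1 x.2.1 x.2.2).trans ?_
  rw [Finset.prod_const, ← Real.exp_nat_mul, mul_assoc]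

theorem integrable_exp_sum [IsProbabilityMeasure P] (h : IsBernoulliArrivals P p a) (θ : ℝ)
    (J : Finset (ℕ × Fin n × Fin n)) :
    Integrable (fun ω => Real.exp (θ * ∑ x ∈ J, (a x.1 ω x.2.1 x.2.2 : ℝ))) P := by
  have hm : Measurable fun ω => Real.exp (θ * ∑ x ∈ J, (a x.1 ω x.2.1 x.2.2 : ℝ)) := by
    refine Real.measurable_exp.comp (measurable_const.mul (Finset.measurable_sum _ fun x _ => ?_))
    exact (Measurable.of_discrete (f := fun x : ℕ => (x : ℝ))).comp (h.measurable _ _ _)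
  refine Integrable.of_bound hm.aestronglyMeasurable (Real.exp (|θ| * J.card)) ?_
  filter_upwards [h.ae_le_one] with ω hω
  rw [Real.norm_eq_abs, Real.abs_exp, Real.exp_le_exp]
  refine (le_abs_self _).trans ?_
  rw [abs_mul]
  refine mul_le_mul_of_nonneg_left ?_ (abs_nonneg _)
  rw [abs_of_nonneg (Finset.sum_nonneg fun _ _ => Nat.cast_nonneg _)]
  calc ∑ x ∈ J, (a x.1 ω x.2.1 x.2.2 : ℝ) ≤ ∑ x ∈ J, (1 : ℝ) :=
        Finset.sum_le_sum fun x _ => by exact_mod_cast hω _ _ _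
    _ = _ := by simp

/-- Chernoff's bound with the Poisson majorant of the moment generating function and `exp θ - 1 ≤ θ
+ θ ^ 2`. -/
theorem measure_sum_ge_le [IsProbabilityMeasure P] (h : IsBernoulliArrivals P p a)
    (J : Finset (ℕ × Fin n × Fin n)) (z : ℝ) {θ : ℝ} (h0 : 0 ≤ θ) (h1 : θ ≤ 1) :
    P.real {ω | z ≤ ∑ x ∈ J, (a x.1 ω x.2.1 x.2.2 : ℝ)} ≤
      Real.exp (-θ * z + J.card * p * (θ + θ ^ 2)) := by
  refine (measure_ge_le_exp_mul_mgf z h0 (h.integrable_exp_sum θ J)).trans ?_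
  rw [Real.exp_add]
  refine mul_le_mul_of_nonneg_left ((h.mgf_sum_le θ J).trans (Real.exp_le_exp.2 ?_))
    (Real.exp_pos _).le
  have h2 := (abs_le.1 (Real.abs_exp_sub_one_sub_id_le (abs_le.2 ⟨by linarith, h1⟩))).2
  exact mul_le_mul_of_nonneg_left (by linarith) (mul_nonneg (Nat.cast_nonneg _) p.2.1)

theorem measure_sum_le_le [IsProbabilityMeasure P] (h : IsBernoulliArrivals P p a)
    (J : Finset (ℕ × Fin n × Fin n)) {z : ℝ} (hJ : 0 < J.card * (p : ℝ)) (hz : z ≤ J.card * p) :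
    P.real {ω | ∑ x ∈ J, (a x.1 ω x.2.1 x.2.2 : ℝ) ≤ z} ≤
      Real.exp (-((J.card * p - z) ^ 2 / (2 * (J.card * p)))) := by
  set μ : ℝ := J.card * p
  -- The minimizer of the quadratic exponent `η z - μ η + μ η ^ 2 / 2`.
  set η : ℝ := (μ - z) / μ with hη
  have hη0 : 0 ≤ η := div_nonneg (by linarith) hJ.le
  refine (measure_le_le_exp_mul_mgf (t := -η) z (by linarith)
    (h.integrable_exp_sum (-η) J)).trans ?_
  refine (mul_le_mul_of_nonneg_left (h.mgf_sum_le (-η) J) (Real.exp_pos _).le).trans ?_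
  rw [← Real.exp_add, Real.exp_le_exp]
  have h2 := mul_le_mul_of_nonneg_left (Real.exp_neg_le_quadratic hη0) hJ.le
  have h3 : η * μ = μ - z := div_mul_cancel₀ _ hJ.ne'
  have h4 : (μ - z) ^ 2 / (2 * μ) = η * (μ - z) / 2 := by
    rw [hη]; field_simp
  have h5 : μ * η ^ 2 = η * (μ - z) := by rw [← h3]; ring
  rw [h4]
  linarith

end IsBernoulliArrivals

/-! ### The probability that a frame has no `k`-factor. -/

theorem hasFactor_zero {n : ℕ} (G : Fin n → Fin n → ℕ) : HasFactor 0 G :=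
  ⟨0, by simp, by simp, by simp⟩

/-- The deviation of a cut of a random bipartite multigraph that obstructs a `k`-factor. The
multigraph has `r` edges per row on average, and the cut has `x` and `y` rows and columns. -/
theorem cut_deviation {n x y r k κ : ℝ} (hn : 0 < n) (hyx : y ≤ x) (hxn : x ≤ n)
    (hxy : n < x + y) (hr : 0 < r) (hk : k ≤ r) (hκ : 0 ≤ κ)
    (h1 : 8 * κ * r ≤ (r - k) ^ 2) (h2 : 128 * κ ≤ r) :
    k * (x + y - n) ≤ r * (x * y) / n ∧
      2 * (r * (x * y) / n) * (κ * y) ≤ (r * (x * y) / n - k * (x + y - n)) ^ 2 := by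
  have hy : 0 < y := by linarith
  have hyn : y ≤ n := hyx.trans hxn
  set μ := r * (x * y) / n with hμ
  have hw : 0 ≤ (n - x) * (n - y) / n :=
    div_nonneg (mul_nonneg (by linarith) (by linarith)) hn.le
  -- Since `x y / n = (x + y - n) + (n - x) (n - y) / n`, the deviation is a sum of two nonnegative
  -- terms, one of which is always large.
  have hμ1 : μ = r * (x + y - n) + r * ((n - x) * (n - y) / n) := by
    rw [hμ]; field_simp; ring
  have hμ2 : μ ≤ r * y := by
    rw [hμ, div_le_iff₀ hn]
    nlinarith [mul_le_mul_of_nonneg_left hxn (mul_pos hr hy).le]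
  have hlam : μ - k * (x + y - n) =
      (r - k) * (x + y - n) + r * ((n - x) * (n - y) / n) := by rw [hμ1]; ring
  have hp1 : 0 ≤ (r - k) * (x + y - n) := mul_nonneg (by linarith) (by linarith)
  have hp2 : 0 ≤ r * ((n - x) * (n - y) / n) := mul_nonneg hr.le hw
  refine ⟨by linarith, ?_⟩
  have hb : 2 * μ * (κ * y) ≤ 2 * (r * y) * (κ * y) :=
    mul_le_mul_of_nonneg_right (by linarith) (mul_nonneg hκ hy.le)
  refine hb.trans ?_
  rw [hlam]
  -- If `n - x ≤ y / 2`, the first term is at least `(r - k) y / 2`, and `h1` applies. Otherwise `y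
  -- ≤ x < n - y / 2` keeps `y` away from `n`, the second term is at least `r y / 8`, and `h2`
  -- applies.
  by_cases hc : n - x ≤ y / 2
  · have h3 : (r - k) * (y / 2) ≤ (r - k) * (x + y - n) + r * ((n - x) * (n - y) / n) := by
      have := mul_le_mul_of_nonneg_left (show y / 2 ≤ x + y - n by linarith)
        (show 0 ≤ r - k by linarith)
      linarith
    calc 2 * (r * y) * (κ * y) = 8 * κ * r * (y ^ 2 / 4) := by ring
      _ ≤ (r - k) ^ 2 * (y ^ 2 / 4) := mul_le_mul_of_nonneg_right h1 (by positivity)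
      _ = ((r - k) * (y / 2)) ^ 2 := by ring
      _ ≤ _ := pow_le_pow_left₀ (mul_nonneg (by linarith) (by linarith)) h3 2
  · have h4 : n / 4 ≤ n - y := by
      by_contra h
      linarith
    have h5 : y / 8 ≤ (n - x) * (n - y) / n := by
      rw [le_div_iff₀ hn]
      have := mul_le_mul (show y / 2 ≤ n - x by linarith) h4 (by linarith) (by linarith)
      linarith
    have h6 : r * (y / 8) ≤ (r - k) * (x + y - n) + r * ((n - x) * (n - y) / n) := by
      have := mul_le_mul_of_nonneg_left h5 hr.le
      linarith
    calc 2 * (r * y) * (κ * y) = 128 * κ * (r * y ^ 2 / 64) := by ring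
      _ ≤ r * (r * y ^ 2 / 64) := mul_le_mul_of_nonneg_right h2 (by positivity)
      _ = (r * (y / 8)) ^ 2 := by ring
      _ ≤ _ := pow_le_pow_left₀ (by positivity) h6 2

namespace IsBernoulliArrivals

variable {Ω : Type*} [MeasurableSpace Ω] {P : Measure Ω} {n : ℕ} {p : unitInterval}
  {a : ℕ → Ω → Fin n → Fin n → ℕ}

/-- Too few arrivals in frame `v` between the rows in `A` and the columns in `B`. -/
def deficientCut (b : BatchParams) (c : ℕ → Fin n → Fin n → ℕ) (v : ℕ) (A B : Finset (Fin n)) :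
    Prop :=
  ∑ i ∈ A, ∑ j ∈ B, b.frame c v i j + b.k * n < b.k * (A.card + B.card)

theorem measure_deficientCut_le [IsProbabilityMeasure P] (h : IsBernoulliArrivals P p a)
    (b : BatchParams) (v : ℕ) {κ : ℝ} (hκ : 0 ≤ κ) (hn : 0 < n)
    (hr : 0 < n * (p : ℝ) * b.s) (hk : b.k ≤ n * (p : ℝ) * b.s)
    (h1 : 8 * κ * (n * (p : ℝ) * b.s) ≤ (n * (p : ℝ) * b.s - b.k) ^ 2)
    (h2 : 128 * κ ≤ n * (p : ℝ) * b.s) (A B : Finset (Fin n)) (hAB : n < A.card + B.card) :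
    P.real {ω | deficientCut b (fun t => a t ω) v A B} ≤
      Real.exp (-(κ * (min A.card B.card : ℕ))) := by
  have hA : A.card ≤ n := by simpa using Finset.card_le_univ A
  have hB : B.card ≤ n := by simpa using Finset.card_le_univ B
  have hA0 : 0 < A.card := by omega
  have hB0 : 0 < B.card := by omega
  set J : Finset (ℕ × Fin n × Fin n) := Finset.Ico (v * b.s) ((v + 1) * b.s) ×ˢ (A ×ˢ B) with hJ
  have hcard : (J.card : ℝ) * p = n * (p : ℝ) * b.s * (A.card * B.card) / n := by
    have : J.card = b.s * (A.card * B.card) := by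
      rw [hJ, Finset.card_product, Finset.card_product, Nat.card_Ico, Nat.succ_mul,
        Nat.add_sub_cancel_left]
    rw [this]
    have : (n : ℝ) ≠ 0 := by positivity
    push_cast
    field_simp
  have hsum : ∀ ω, ∑ x ∈ J, (a x.1 ω x.2.1 x.2.2 : ℝ) =
      ((∑ i ∈ A, ∑ j ∈ B, b.frame (fun t => a t ω) v i j : ℕ) : ℝ) := by
    intro ω
    rw [hJ, Finset.sum_product_right, Finset.sum_product]
    simp [BatchParams.frame]
  have hp0 : 0 < (p : ℝ) := by
    rcases p.2.1.eq_or_lt with h0 | h0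
    · simp [← h0] at hr
    · exact h0
  have hs0 : (0 : ℝ) < b.s := by exact_mod_cast b.s_pos
  have hnR : (0 : ℝ) < n := by exact_mod_cast hn
  have hdev : b.k * ((A.card : ℝ) + B.card - n) ≤ J.card * (p : ℝ) ∧
      2 * (J.card * (p : ℝ)) * (κ * (min A.card B.card : ℕ)) ≤
        (J.card * (p : ℝ) - b.k * ((A.card : ℝ) + B.card - n)) ^ 2 := by
    rw [hcard]
    rcases le_total B.card A.card with hle | hle
    · rw [min_eq_right hle]
      exact cut_deviation hnR (by exact_mod_cast hle) (by exact_mod_cast hA)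
        (by exact_mod_cast hAB) hr hk hκ h1 h2
    · rw [min_eq_left hle, mul_comm (A.card : ℝ), add_comm (A.card : ℝ)]
      exact cut_deviation hnR (by exact_mod_cast hle) (by exact_mod_cast hB)
        (by rw [add_comm]; exact_mod_cast hAB) hr hk hκ h1 h2
  have hpos : 0 < J.card * (p : ℝ) := by rw [hcard]; positivity
  refine le_trans ?_ ((h.measure_sum_le_le J hpos hdev.1).trans ?_)
  · refine measureReal_mono fun ω hω => ?_
    have hω' : deficientCut b (fun t => a t ω) v A B := hω
    change ∑ x ∈ J, (a x.1 ω x.2.1 x.2.2 : ℝ) ≤ _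
    rw [hsum]
    have h3 : ((∑ i ∈ A, ∑ j ∈ B, b.frame (fun t => a t ω) v i j : ℕ) : ℝ) + b.k * n ≤
        b.k * (A.card + B.card) := by exact_mod_cast hω'.le
    linarith
  · rw [Real.exp_le_exp, neg_le_neg_iff, le_div_iff₀ (by positivity)]
    have := hdev.2
    push_cast at this ⊢
    linarith

/-- A union bound over all cuts. The factor `exp (-κ * min |A| |B|)` beats the number of cuts,
because a deficient cut has `|A| + |B| > n`, so the complement of the larger side is smaller than
the smaller side. -/
theorem measure_not_hasFactor_le [IsProbabilityMeasure P] (h : IsBernoulliArrivals P p a)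
    (b : BatchParams) (v : ℕ) {κ : ℝ} (hκ : 0 ≤ κ) (hn : 0 < n)
    (hr : 0 < n * (p : ℝ) * b.s) (hk : b.k ≤ n * (p : ℝ) * b.s)
    (h1 : 8 * κ * (n * (p : ℝ) * b.s) ≤ (n * (p : ℝ) * b.s - b.k) ^ 2)
    (h2 : 128 * κ ≤ n * (p : ℝ) * b.s) (h3 : n * Real.exp (-(κ / 3)) ≤ 1 / 2) :
    P.real {ω | ¬ HasFactor b.k (b.frame (fun t => a t ω) v)} ≤ 6 * Real.exp (-(κ / 3)) := by
  classical
  set β := Real.exp (-(κ / 3)) with hβ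
  have hβ0 : 0 < β := Real.exp_pos _
  have hexp : ∀ m l : ℕ, l ≤ 3 * m → Real.exp (-(κ * m)) ≤ β ^ l := by
    intro m l hl
    rw [hβ, ← Real.exp_nat_mul, Real.exp_le_exp]
    have : (l : ℝ) ≤ 3 * m := by exact_mod_cast hl
    nlinarith
  -- The symmetric bound replaces the minimum by a sum of two products, which binomial summation
  -- turns into `(β + 1) ^ n * (β + 1) ^ n`.
  have hcut : ∀ A B : Finset (Fin n),
      P.real {ω | deficientCut b (fun t => a t ω) v A B} ≤
        β * (β ^ (n - A.card) * β ^ B.card + β ^ A.card * β ^ (n - B.card)) := by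
    intro A B
    by_cases hAB : n < A.card + B.card
    · have hA : A.card ≤ n := by simpa using Finset.card_le_univ A
      have hB : B.card ≤ n := by simpa using Finset.card_le_univ B
      refine (h.measure_deficientCut_le b v hκ hn hr hk h1 h2 A B hAB).trans ?_
      rw [mul_add, ← pow_add, ← pow_add, ← pow_succ', ← pow_succ']
      rcases le_total B.card A.card with hle | hle
      · rw [min_eq_right hle]
        exact (hexp B.card _ (by omega)).trans (le_add_of_nonneg_right (by positivity))
      · rw [min_eq_left hle]
        exact (hexp A.card _ (by omega)).trans (le_add_of_nonneg_left (by positivity))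
    · have : {ω | deficientCut b (fun t => a t ω) v A B} = ∅ := by
        ext ω
        simp only [Set.mem_ofPred_eq, Set.mem_empty_iff_false, iff_false, deficientCut, not_lt]
        exact (Nat.mul_le_mul_left _ (not_lt.1 hAB)).trans (Nat.le_add_left _ _)
      rw [this]
      simp only [measureReal_empty]
      positivity
  have hsub : {ω | ¬ HasFactor b.k (b.frame (fun t => a t ω) v)} ⊆
      ⋃ x ∈ (Finset.univ : Finset (Finset (Fin n) × Finset (Fin n))),
        {ω | deficientCut b (fun t => a t ω) v x.1 x.2} := by
    intro ω hω
    by_contra hcon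
    refine hω (hasFactor_of_le _ _ fun A B => ?_)
    simp only [Set.mem_iUnion, not_exists] at hcon
    exact not_lt.1 (hcon (A, B) (Finset.mem_univ _))
  have hs1 : ∑ A : Finset (Fin n), β ^ A.card = (β + 1) ^ n := by
    simpa using Fintype.sum_pow_mul_eq_add_pow (Fin n) β 1
  have hs2 : ∑ A : Finset (Fin n), β ^ (n - A.card) = (β + 1) ^ n := by
    simpa [add_comm] using Fintype.sum_pow_mul_eq_add_pow (Fin n) 1 β
  have hpow : (β + 1) ^ n * (β + 1) ^ n ≤ 3 := by
    have h4 : (β + 1) ^ n ≤ Real.exp (1 / 2) := by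
      calc (β + 1) ^ n ≤ Real.exp β ^ n :=
            pow_le_pow_left₀ (by positivity) (Real.add_one_le_exp _) n
        _ = Real.exp (n * β) := (Real.exp_nat_mul _ _).symm
        _ ≤ _ := Real.exp_le_exp.2 h3
    calc (β + 1) ^ n * (β + 1) ^ n ≤ Real.exp (1 / 2) * Real.exp (1 / 2) :=
          mul_le_mul h4 h4 (by positivity) (Real.exp_pos _).le
      _ = Real.exp 1 := by rw [← Real.exp_add]; norm_num
      _ ≤ 3 := Real.exp_one_lt_three.le
  calc P.real {ω | ¬ HasFactor b.k (b.frame (fun t => a t ω) v)}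
      ≤ ∑ x : Finset (Fin n) × Finset (Fin n),
          P.real {ω | deficientCut b (fun t => a t ω) v x.1 x.2} :=
        (measureReal_mono hsub (measure_ne_top _ _)).trans (measureReal_biUnion_finset_le _ _)
    _ ≤ ∑ x : Finset (Fin n) × Finset (Fin n),
          β * (β ^ (n - x.1.card) * β ^ x.2.card + β ^ x.1.card * β ^ (n - x.2.card)) :=
        Finset.sum_le_sum fun x _ => hcut x.1 x.2
    _ = 2 * β * ((β + 1) ^ n * (β + 1) ^ n) := by
        rw [Fintype.sum_prod_type]
        simp only [← Finset.mul_sum, Finset.sum_add_distrib, ← Finset.sum_mul, hs1, hs2]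
        ring
    _ ≤ 2 * β * 3 := mul_le_mul_of_nonneg_left hpow (by positivity)
    _ = 6 * β := by ring

end IsBernoulliArrivals

/-! ### Overflow of a batch and the size of the backlog. -/

namespace BatchParams

variable (b : BatchParams) {n : ℕ} (a : ℕ → Fin n → Fin n → ℕ)

theorem sum_frame_batch (u : ℕ) (i j : Fin n) :
    ∑ v ∈ Finset.Ico (u * b.m) ((u + 1) * b.m), b.frame a v i j =
      ∑ t ∈ Finset.Ico (u * b.T) ((u + 1) * b.T), a t i j := by
  have h1 := Finset.sum_range_add_sum_Ico (fun v => b.frame a v i j)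
    (Nat.mul_le_mul_right b.m (Nat.le_add_right u 1))
  have h2 := Finset.sum_range_add_sum_Ico (fun t => a t i j)
    (Nat.mul_le_mul_right b.T (Nat.le_add_right u 1))
  rw [sum_frame, sum_frame, mul_assoc, mul_assoc] at h1
  change _ + _ = ∑ t ∈ Finset.range ((u + 1) * b.T), a t i j at h1
  change ∑ t ∈ Finset.range (u * b.T), a t i j + _ = _ at h1
  omega

theorem residual_add (u : ℕ) (i j : Fin n) :
    b.residual a u i j + ∑ v ∈ Finset.Ico (u * b.m) ((u + 1) * b.m), b.regular a v i j =
      ∑ t ∈ Finset.Ico (u * b.T) ((u + 1) * b.T), a t i j := by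
  rw [← sum_frame_batch, residual, ← Finset.sum_add_distrib]
  exact Finset.sum_congr rfl fun v _ => Nat.sub_add_cancel (b.regular_le a v i j)

theorem d_add_one_add : b.d + 1 + b.m * b.k = b.T := by
  rw [d_add_one, ← mul_add, Nat.sub_add_cancel b.k_lt.le, T]

/-- The factors remove exactly `m k` packets from each line, and `T - m k = d + 1`; so fewer than
`T` arrivals leave at most `d` residual packets. -/
theorem not_overflows {u : ℕ}
    (hf : ∀ v ∈ Finset.Ico (u * b.m) ((u + 1) * b.m), HasFactor b.k (b.frame a v))
    (hr : ∀ i, ∑ j, ∑ t ∈ Finset.Ico (u * b.T) ((u + 1) * b.T), a t i j < b.T)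
    (hc : ∀ j, ∑ i, ∑ t ∈ Finset.Ico (u * b.T) ((u + 1) * b.T), a t i j < b.T) :
    ¬ b.Overflows a u := by
  have hcard : (Finset.Ico (u * b.m) ((u + 1) * b.m)).card = b.m := by
    rw [Nat.card_Ico, Nat.succ_mul, Nat.add_sub_cancel_left]
  have hd := b.d_add_one_add
  refine not_not.2 ⟨fun i => ?_, fun j => ?_⟩
  · have h1 := hr i
    simp_rw [← residual_add] at h1
    rw [Finset.sum_add_distrib, Finset.sum_comm (s := Finset.univ)
      (t := Finset.Ico (u * b.m) ((u + 1) * b.m)),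
      Finset.sum_congr rfl fun v hv =>
        show ∑ j, b.regular a v i j = b.k from (hf v hv).sum_factor_row i] at h1
    rw [Finset.sum_const, hcard, smul_eq_mul] at h1
    omega
  · have h1 := hc j
    simp_rw [← residual_add] at h1
    rw [Finset.sum_add_distrib, Finset.sum_comm (s := Finset.univ)
      (t := Finset.Ico (u * b.m) ((u + 1) * b.m)),
      Finset.sum_congr rfl fun v hv =>
        show ∑ i, b.regular a v i j = b.k from (hf v hv).sum_factor_col j] at h1
    rw [Finset.sum_const, hcard, smul_eq_mul] at h1
    omega

/-- The number of packets in the backlog at the beginning of batch `u`. -/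
noncomputable def backlogSize (u : ℕ) : ℕ := ∑ i, ∑ j, b.backlog a u i j

theorem sum_spilled_le (ha : ∀ t i j, a t i j ≤ 1) (u : ℕ) :
    ∑ i, ∑ j, b.spilled a u i j ≤ n * n * b.T := by
  have h : ∀ i j, b.spilled a u i j ≤ b.T := by
    intro i j
    calc b.spilled a u i j ≤ b.residual a u i j := by
          rw [← b.kept_add_spilled a]; exact Nat.le_add_left _ _
      _ ≤ ∑ t ∈ Finset.Ico (u * b.T) ((u + 1) * b.T), a t i j := by
          rw [← b.residual_add a]; exact Nat.le_add_right _ _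
      _ ≤ ∑ t ∈ Finset.Ico (u * b.T) ((u + 1) * b.T), 1 :=
          Finset.sum_le_sum fun t _ => ha t i j
      _ = b.T := by simp [Nat.succ_mul]
  calc ∑ i, ∑ j, b.spilled a u i j ≤ ∑ _i : Fin n, ∑ _j : Fin n, b.T :=
        Finset.sum_le_sum fun i _ => Finset.sum_le_sum fun j _ => h i j
    _ = _ := by simp [mul_assoc]

open Classical in
theorem backlogSize_succ_le (ha : ∀ t i j, a t i j ≤ 1) (u : ℕ) :
    b.backlogSize a (u + 1) ≤
      (b.backlogSize a u - 1) + if b.Overflows a u then n * n * b.T else 0 := by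
  have h1 : b.backlogSize a (u + 1) = (b.backlogSize a u - 1) + ∑ i, ∑ j, b.spilled a u i j := by
    simp only [backlogSize, backlog, Finset.sum_add_distrib]
    rw [sum_onePacket]
  rw [h1]
  refine Nat.add_le_add_left ?_ _
  split_ifs with h
  · exact b.sum_spilled_le a ha u
  · simp [spilled, h]

theorem backlogSize_le (ha : ∀ t i j, a t i j ≤ 1) (u : ℕ) :
    b.backlogSize a u ≤ u * (n * n * b.T) := by
  induction u with
  | zero => simp [backlogSize, backlog]
  | succ u ih =>
    have := b.backlogSize_succ_le a ha u
    rw [Nat.succ_mul]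
    split_ifs at this <;> omega

end BatchParams

namespace IsBernoulliArrivals

variable {Ω : Type*} [MeasurableSpace Ω] {P : Measure Ω} {n : ℕ} {p : unitInterval}
  {a : ℕ → Ω → Fin n → Fin n → ℕ}

theorem measure_overflows_le [IsProbabilityMeasure P] (h : IsBernoulliArrivals P p a)
    (b : BatchParams) (u : ℕ) {pb : ℝ} (hp : n * (p : ℝ) ≤ 1)
    (hpb : ∀ v, P.real {ω | ¬ HasFactor b.k (b.frame (fun t => a t ω) v)} ≤ pb) :
    P.real {ω | b.Overflows (fun t => a t ω) u} ≤
      b.m * pb + 2 * n * Real.exp (-((1 - n * (p : ℝ)) ^ 2 * b.T / 4)) := by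
  classical
  set I := Finset.Ico (u * b.T) ((u + 1) * b.T) with hI
  have hIcard : I.card = b.T := by rw [hI, Nat.card_Ico, Nat.succ_mul, Nat.add_sub_cancel_left]
  set ρ : ℝ := n * (p : ℝ) with hρ
  have hρ0 : 0 ≤ ρ := mul_nonneg (Nat.cast_nonneg _) p.2.1
  have hT : (0 : ℝ) ≤ b.T := Nat.cast_nonneg _
  have hline : ∀ J : Finset (ℕ × Fin n × Fin n), J.card = b.T * n →
      P.real {ω | (b.T : ℝ) ≤ ∑ x ∈ J, (a x.1 ω x.2.1 x.2.2 : ℝ)} ≤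
        Real.exp (-((1 - ρ) ^ 2 * b.T / 4)) := by
    intro J hJ
    -- This `θ` minimizes `-θ T + T ρ θ + T θ ^ 2`, the exponent with `ρ` replaced by `1` in its
    -- quadratic term.
    refine (h.measure_sum_ge_le J b.T (θ := (1 - ρ) / 2) (by linarith) (by linarith)).trans ?_
    rw [Real.exp_le_exp, hJ]
    have h1 : ((b.T * n : ℕ) : ℝ) * p = b.T * ρ := by rw [hρ]; push_cast; ring
    rw [h1]
    have h2 : 0 ≤ (b.T : ℝ) * (1 - ρ) ^ 3 := mul_nonneg hT (pow_nonneg (by linarith) 3)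
    nlinarith
  have hrow : ∀ i, P.real {ω | b.T ≤ ∑ j, ∑ t ∈ I, a t ω i j} ≤
      Real.exp (-((1 - ρ) ^ 2 * b.T / 4)) := by
    intro i
    have h1 := hline (I ×ˢ ({i} ×ˢ Finset.univ)) (by simp [hIcard])
    refine le_trans (le_of_eq ?_) h1
    congr 1
    ext ω
    rw [Set.mem_ofPred_eq, Set.mem_ofPred_eq, Finset.sum_product_right, Finset.sum_product]
    simp only [Finset.sum_singleton]
    exact_mod_cast Iff.rfl
  have hcol : ∀ j, P.real {ω | b.T ≤ ∑ i, ∑ t ∈ I, a t ω i j} ≤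
      Real.exp (-((1 - ρ) ^ 2 * b.T / 4)) := by
    intro j
    have h1 := hline (I ×ˢ (Finset.univ ×ˢ {j})) (by simp [hIcard])
    refine le_trans (le_of_eq ?_) h1
    congr 1
    ext ω
    rw [Set.mem_ofPred_eq, Set.mem_ofPred_eq, Finset.sum_product_right, Finset.sum_product]
    simp only [Finset.sum_singleton]
    exact_mod_cast Iff.rfl
  have hsub : {ω | b.Overflows (fun t => a t ω) u} ⊆
      ((⋃ v ∈ Finset.Ico (u * b.m) ((u + 1) * b.m),
        {ω | ¬ HasFactor b.k (b.frame (fun t => a t ω) v)}) ∪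
      ⋃ i ∈ (Finset.univ : Finset (Fin n)), {ω | b.T ≤ ∑ j, ∑ t ∈ I, a t ω i j}) ∪
      ⋃ j ∈ (Finset.univ : Finset (Fin n)), {ω | b.T ≤ ∑ i, ∑ t ∈ I, a t ω i j} := by
    intro ω hω
    by_contra hcon
    simp only [Set.mem_union, Set.mem_iUnion, Set.mem_ofPred_eq, not_or, not_exists, not_not,
      not_le] at hcon
    exact b.not_overflows _ (fun v hv => hcon.1.1 v hv) (fun i => hcon.1.2 i (Finset.mem_univ _))
      (fun j => hcon.2 j (Finset.mem_univ _)) hω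
  have hm : (Finset.Ico (u * b.m) ((u + 1) * b.m)).card = b.m := by
    rw [Nat.card_Ico, Nat.succ_mul, Nat.add_sub_cancel_left]
  calc P.real {ω | b.Overflows (fun t => a t ω) u} ≤ _ :=
        measureReal_mono hsub (measure_ne_top _ _)
    _ ≤ _ := measureReal_union_le _ _
    _ ≤ _ := add_le_add_left (measureReal_union_le _ _) _
    _ ≤ (∑ _v ∈ Finset.Ico (u * b.m) ((u + 1) * b.m), pb +
        ∑ _i : Fin n, Real.exp (-((1 - ρ) ^ 2 * b.T / 4))) +
        ∑ _j : Fin n, Real.exp (-((1 - ρ) ^ 2 * b.T / 4)) := by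
      refine add_le_add (add_le_add ?_ ?_) ?_
      · exact (measureReal_biUnion_finset_le _ _).trans (Finset.sum_le_sum fun v _ => hpb v)
      · exact (measureReal_biUnion_finset_le _ _).trans (Finset.sum_le_sum fun i _ => hrow i)
      · exact (measureReal_biUnion_finset_le _ _).trans (Finset.sum_le_sum fun j _ => hcol j)
    _ = _ := by
      simp only [Finset.sum_const, hm, nsmul_eq_mul, Finset.card_univ, Fintype.card_fin]
      ring

theorem measurable_backlogSize (h : IsBernoulliArrivals P p a) (b : BatchParams) (u : ℕ)
    {β : Type*} [MeasurableSpace β] (f : ℕ → β) :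
    Measurable fun ω => f (b.backlogSize (fun t => a t ω) u) :=
  h.measurable_of_dependsOn (J := Finset.range (u * b.T))
    (g := fun c => f (b.backlogSize c u)) fun c c' hc => by
      simp only [BatchParams.backlogSize, b.backlog_congr hc]

theorem integrable_backlogSize [IsProbabilityMeasure P] (h : IsBernoulliArrivals P p a)
    (b : BatchParams) (u : ℕ) (f : ℕ → ℝ) :
    Integrable (fun ω => f (b.backlogSize (fun t => a t ω) u)) P := by
  refine Integrable.of_bound (h.measurable_backlogSize b u f).aestronglyMeasurable
    (∑ w ∈ Finset.range (u * (n * n * b.T) + 1), ‖f w‖) ?_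
  filter_upwards [h.ae_le_one] with ω hω
  exact Finset.single_le_sum (f := fun w => ‖f w‖) (fun _ _ => norm_nonneg _)
    (Finset.mem_range.2 (Nat.lt_succ_of_le (b.backlogSize_le _ hω u)))

open Classical in
/-- Exponential moment of the backlog: it is bounded by its geometric drift. -/
theorem integral_exp_backlogSize_le [IsProbabilityMeasure P] (h : IsBernoulliArrivals P p a)
    (b : BatchParams) {pf : ℝ} (hn : 0 < n)
    (hpf : ∀ u, P.real {ω | b.Overflows (fun t => a t ω) u} ≤ pf)
    (hB : 8 * pf * (n * n * b.T) ≤ 1) (u : ℕ) :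
    ∫ ω, Real.exp (b.backlogSize (fun t => a t ω) u / (n * n * b.T)) ∂P ≤
      1 + 8 * pf * (n * n * b.T) := by
  have hpf0 : 0 ≤ pf := measureReal_nonneg.trans (hpf 0)
  have hB1 : (1 : ℝ) ≤ n * n * b.T := by
    exact_mod_cast Nat.mul_pos (Nat.mul_pos hn hn) b.T_pos
  set B : ℝ := n * n * b.T with hBdef
  have hB0 : 0 < B := by linarith
  induction u with
  | zero =>
    simp [BatchParams.backlogSize, BatchParams.backlog]
    positivity
  | succ u ih =>
    set q := Real.exp (-(1 / B)) with hq
    have hq0 : 0 < q := Real.exp_pos _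
    have hq1 : q ≤ 1 - 1 / B / 2 := by
      have h1 := Real.exp_neg_le_quadratic (x := 1 / B) (by positivity)
      have h2 : 1 / B ≤ 1 := by rw [div_le_one hB0]; exact hB1
      have h3 : 0 < 1 / B := by positivity
      nlinarith
    -- Bounds `exp ((w - 1) / B)` with truncated subtraction; the constant `1 - q` covers the empty
    -- backlog.
    let f : ℕ → ℝ := fun w => q * Real.exp (w / B) + (1 - q)
    let g : (ℕ → Fin n → Fin n → ℕ) → ℝ := fun c => if b.Overflows c u then 1 else 0
    have hg : ∀ c c', (∀ t ∈ Finset.Ico (u * b.T) ((u + 1) * b.T), c t = c' t) → g c = g c' := by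
      intro c c' hc
      simp only [g, b.overflows_congr hc]
    have hgm := h.measurable_of_dependsOn hg
    have hfi := h.integrable_backlogSize b u f
    have hgset : MeasurableSet {ω | b.Overflows (fun t => a t ω) u} := by
      convert hgm (measurableSet_singleton 1) using 1
      ext ω
      simp [g]
    have hgind : (fun ω => g fun t => a t ω) =
        {ω | b.Overflows (fun t => a t ω) u}.indicator fun _ => 1 := by
      ext ω
      simp [g, Set.indicator_apply]
    have hgi : Integrable (fun ω => g fun t => a t ω) P := by
      rw [hgind]
      exact (integrable_const 1).indicator hgset
    have hgint : ∫ ω, g (fun t => a t ω) ∂P ≤ pf := by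
      rw [hgind, integral_indicator_const _ hgset]
      simpa using hpf u
    -- The backlog at the start of batch `u` depends on earlier slots only, the overflow on the
    -- slots of the batch itself.
    have hind : IndepFun (fun ω => f (b.backlogSize (fun t => a t ω) u))
        (fun ω => g fun t => a t ω) P :=
      h.indepFun_of_dependsOn (J := Finset.range (u * b.T)) (f := fun c => f (b.backlogSize c u))
        (by
          rw [Finset.disjoint_left]
          intro t ht ht'
          simp only [Finset.mem_range, Finset.mem_Ico] at ht ht'
          omega)
        (fun c c' hc => by simp only [BatchParams.backlogSize, b.backlog_congr hc]) hg
    have hmul := hind.integral_fun_mul_eq_mul_integral hfi.aestronglyMeasurable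
      hgi.aestronglyMeasurable
    have hmuli : Integrable (fun ω => f (b.backlogSize (fun t => a t ω) u) *
        g fun t => a t ω) P := hind.integrable_mul hfi hgi
    -- An overflow adds at most `B`, hence multiplies the exponential by at most `exp 1 < 3 = 1 +
    -- 2`.
    have hstep : ∀ᵐ ω ∂P, Real.exp (b.backlogSize (fun t => a t ω) (u + 1) / B) ≤
        f (b.backlogSize (fun t => a t ω) u) +
          2 * (f (b.backlogSize (fun t => a t ω) u) * g fun t => a t ω) := by
      filter_upwards [h.ae_le_one] with ω hω
      have h1 := b.backlogSize_succ_le _ hω u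
      set w := b.backlogSize (fun t => a t ω) u
      have h2 : Real.exp ((w - 1 : ℕ) / B) ≤ f w := by
        rcases Nat.eq_zero_or_pos w with h0 | h0
        · simp [f, h0]
        · have : Real.exp ((w - 1 : ℕ) / B) = q * Real.exp (w / B) := by
            rw [hq, ← Real.exp_add]
            congr 1
            push_cast [Nat.cast_sub h0]
            ring
          rw [this]
          have : q ≤ 1 := by have : 0 < 1 / B := by positivity
                             linarith
          simp only [f]
          linarith
      by_cases hov : b.Overflows (fun t => a t ω) u
      · rw [if_pos hov] at h1
        have h3 : (b.backlogSize (fun t => a t ω) (u + 1) : ℝ) ≤ (w - 1 : ℕ) + B := by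
          rw [hBdef]; exact_mod_cast h1
        simp only [g, if_pos hov]
        calc Real.exp (b.backlogSize (fun t => a t ω) (u + 1) / B)
            ≤ Real.exp ((w - 1 : ℕ) / B + 1) := by
              rw [Real.exp_le_exp, div_add_one hB0.ne']
              exact div_le_div_of_nonneg_right h3 hB0.le
          _ = Real.exp ((w - 1 : ℕ) / B) * Real.exp 1 := Real.exp_add _ _
          _ ≤ f w * 3 := mul_le_mul h2 Real.exp_one_lt_three.le (Real.exp_pos _).le
              ((Real.exp_pos _).le.trans h2)
          _ = _ := by ring
      · rw [if_neg hov, add_zero] at h1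
        simp only [g, if_neg hov, mul_zero, add_zero]
        refine le_trans (Real.exp_le_exp.2 ?_) h2
        exact div_le_div_of_nonneg_right (by exact_mod_cast h1) hB0.le
    have hfint : ∫ ω, f (b.backlogSize (fun t => a t ω) u) ∂P ≤ 1 + q * (8 * pf * B) := by
      simp only [f]
      rw [integral_add ((h.integrable_backlogSize b u fun w => Real.exp (w / B)).const_mul q)
        (integrable_const _), integral_const_mul]
      simp only [integral_const, probReal_univ, one_smul]
      nlinarith
    have hf0 : 0 ≤ ∫ ω, f (b.backlogSize (fun t => a t ω) u) ∂P := by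
      refine integral_nonneg fun ω => ?_
      have : q ≤ 1 := by
        have : 0 < 1 / B := by positivity
        linarith
      have := mul_nonneg hq0.le (Real.exp_pos (b.backlogSize (fun t => a t ω) u / B)).le
      simp only [f, Pi.zero_apply]
      linarith
    calc ∫ ω, Real.exp (b.backlogSize (fun t => a t ω) (u + 1) / B) ∂P
        ≤ ∫ ω, (f (b.backlogSize (fun t => a t ω) u) +
          2 * (f (b.backlogSize (fun t => a t ω) u) * g fun t => a t ω)) ∂P :=
          integral_mono_ae (h.integrable_backlogSize b (u + 1) fun w => Real.exp (w / B))
            (hfi.add (hmuli.const_mul 2)) hstep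
      _ = (∫ ω, f (b.backlogSize (fun t => a t ω) u) ∂P) *
            (1 + 2 * ∫ ω, g (fun t => a t ω) ∂P) := by
          rw [integral_add hfi (hmuli.const_mul 2), integral_const_mul, hmul]
          ring
      _ ≤ (1 + q * (8 * pf * B)) * (1 + 2 * pf) := by
          refine mul_le_mul hfint (by linarith) ?_ (hf0.trans hfint)
          have : 0 ≤ ∫ ω, g (fun t => a t ω) ∂P := integral_nonneg fun ω => by
            simp only [g]; split_ifs <;> simp
          linarith
      _ ≤ _ := by
          -- The drift gains `4 * pf`, which pays for the factor `1 + 2 * pf` as long as `8 * pf * B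
          -- ≤ 1`.
          have h1 : q * (8 * pf * B) ≤ 8 * pf * B - 4 * pf := by
            have := mul_le_mul_of_nonneg_right hq1 (show 0 ≤ 8 * pf * B by positivity)
            have h2 : (1 - 1 / B / 2) * (8 * pf * B) = 8 * pf * B - 4 * pf := by
              field_simp
              ring
            linarith
          nlinarith

/-- Follows from the exponential moment by `w ≤ B (exp (w / B) - 1)`. -/
theorem integral_backlogSize_le [IsProbabilityMeasure P] (h : IsBernoulliArrivals P p a)
    (b : BatchParams) {pf : ℝ} (hn : 0 < n)
    (hpf : ∀ u, P.real {ω | b.Overflows (fun t => a t ω) u} ≤ pf)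
    (hB : 8 * pf * (n * n * b.T) ≤ 1) (u : ℕ) :
    ∫ ω, (b.backlogSize (fun t => a t ω) u : ℝ) ∂P ≤ 8 * pf * (n * n * b.T) ^ 2 := by
  have hB0 : (0 : ℝ) < n * n * b.T := by
    exact_mod_cast Nat.mul_pos (Nat.mul_pos hn hn) b.T_pos
  have h0 := h.integral_exp_backlogSize_le b hn hpf hB u
  set B : ℝ := n * n * b.T
  have h1 : ∫ ω, (b.backlogSize (fun t => a t ω) u : ℝ) ∂P ≤
      ∫ ω, B * (Real.exp (b.backlogSize (fun t => a t ω) u / B) - 1) ∂P := by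
    refine integral_mono (h.integrable_backlogSize b u fun w => (w : ℝ))
      (h.integrable_backlogSize b u fun w => B * (Real.exp (w / B) - 1)) fun ω => ?_
    have := mul_le_mul_of_nonneg_left
      (Real.add_one_le_exp (b.backlogSize (fun t => a t ω) u / B)) hB0.le
    rw [mul_add, mul_div_cancel₀ _ hB0.ne'] at this
    simp only
    linarith
  refine h1.trans ?_
  rw [integral_const_mul, integral_sub (h.integrable_backlogSize b u fun w => Real.exp (w / B))
    (integrable_const _)]
  simp only [integral_const, probReal_univ, one_smul]
  calc B * (∫ ω, Real.exp (b.backlogSize (fun t => a t ω) u / B) ∂P - 1)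
      ≤ B * (8 * pf * B) := mul_le_mul_of_nonneg_left (by linarith) hB0.le
    _ = _ := by ring

end IsBernoulliArrivals

/-! ### The expected total queue size of the batching policy. -/

namespace BatchParams

variable (b : BatchParams) {n : ℕ} (a : ℕ → Fin n → Fin n → ℕ)

/-- The number of packets that arrive in frame `v`. -/
def frameSize (v : ℕ) : ℕ := ∑ i, ∑ j, b.frame a v i j

open Classical in
theorem sum_frame_sub_regular_le (v : ℕ) :
    (∑ i, ∑ j, (b.frame a v i j - b.regular a v i j)) + n * b.k ≤
      b.frameSize a v + n * b.k * if HasFactor b.k (b.frame a v) then 0 else 1 := by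
  by_cases h : HasFactor b.k (b.frame a v)
  · have h1 : (∑ i, ∑ j, (b.frame a v i j - b.regular a v i j)) + ∑ i, ∑ j, b.regular a v i j =
        b.frameSize a v := by
      simp_rw [frameSize, ← Finset.sum_add_distrib]
      exact Finset.sum_congr rfl fun i _ => Finset.sum_congr rfl fun j _ =>
        Nat.sub_add_cancel (b.regular_le a v i j)
    have h2 : ∑ i, ∑ j, b.regular a v i j = n * b.k := by
      rw [Finset.sum_congr rfl fun i _ =>
        show ∑ j, b.regular a v i j = b.k from h.sum_factor_row i]
      simp
    rw [if_pos h]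
    omega
  · rw [if_neg h, mul_one]
    refine Nat.add_le_add_right ?_ _
    exact Finset.sum_le_sum fun i _ => Finset.sum_le_sum fun j _ => Nat.sub_le _ _

open Classical in
theorem sum_queue_policy_le (t : ℕ) :
    (∑ i, ∑ j, ((b.policy n).queue a t i j : ℝ)) ≤
      b.frameSize a (t / b.s) + n * b.k +
        ∑ v ∈ Finset.Ico (t / b.T * b.m) (t / b.s), ((b.frameSize a v : ℝ) - n * b.k +
          n * b.k * if HasFactor b.k (b.frame a v) then 0 else 1) +
        n * b.d + b.backlogSize a (t / b.T) := by
  have h1 : ∑ i, ∑ j, (b.policy n).queue a t i j ≤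
      b.frameSize a (t / b.s) + ∑ i, ∑ j, delay (b.regular a) (t / b.s) i j +
      ∑ v ∈ Finset.Ico (t / b.T * b.m) (t / b.s),
        ∑ i, ∑ j, (b.frame a v i j - b.regular a v i j) +
      ∑ i, ∑ j, delay (b.kept a) (t / b.T) i j + b.backlogSize a (t / b.T) := by
    have hswap : ∑ v ∈ Finset.Ico (t / b.T * b.m) (t / b.s),
        ∑ i, ∑ j, (b.frame a v i j - b.regular a v i j) =
        ∑ i, ∑ j, ∑ v ∈ Finset.Ico (t / b.T * b.m) (t / b.s),
          (b.frame a v i j - b.regular a v i j) := by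
      rw [Finset.sum_comm]
      exact Finset.sum_congr rfl fun i _ => Finset.sum_comm
    rw [hswap]
    simp_rw [frameSize, backlogSize, ← Finset.sum_add_distrib]
    exact Finset.sum_le_sum fun i _ => Finset.sum_le_sum fun j _ => b.queue_policy_le a t i j
  have h2 : ∑ i, ∑ j, delay (b.regular a) (t / b.s) i j ≤ n * b.k := by
    calc _ ≤ ∑ _i : Fin n, b.k :=
          Finset.sum_le_sum fun i _ => b.sum_delay_regular_row_le a _ i
      _ = _ := by simp
  have h3 : ∑ i, ∑ j, delay (b.kept a) (t / b.T) i j ≤ n * b.d := by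
    calc _ ≤ ∑ _i : Fin n, b.d :=
          Finset.sum_le_sum fun i _ => b.sum_delay_kept_row_le a _ i
      _ = _ := by simp
  have h4 : ((∑ v ∈ Finset.Ico (t / b.T * b.m) (t / b.s),
        ∑ i, ∑ j, (b.frame a v i j - b.regular a v i j) : ℕ) : ℝ) ≤
      ∑ v ∈ Finset.Ico (t / b.T * b.m) (t / b.s), ((b.frameSize a v : ℝ) - n * b.k +
          n * b.k * if HasFactor b.k (b.frame a v) then 0 else 1) := by
    rw [Nat.cast_sum]
    refine Finset.sum_le_sum fun v _ => ?_
    have h5 := b.sum_frame_sub_regular_le a v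
    have h6 : ((∑ i, ∑ j, (b.frame a v i j - b.regular a v i j) : ℕ) : ℝ) + n * b.k ≤
        b.frameSize a v + n * b.k * if HasFactor b.k (b.frame a v) then 0 else 1 := by
      split_ifs at h5 ⊢ <;> exact_mod_cast h5
    linarith
  have h1' : ((∑ i, ∑ j, (b.policy n).queue a t i j : ℕ) : ℝ) ≤
      b.frameSize a (t / b.s) + (∑ i, ∑ j, delay (b.regular a) (t / b.s) i j : ℕ) +
      (∑ v ∈ Finset.Ico (t / b.T * b.m) (t / b.s),
        ∑ i, ∑ j, (b.frame a v i j - b.regular a v i j) : ℕ) +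
      (∑ i, ∑ j, delay (b.kept a) (t / b.T) i j : ℕ) + b.backlogSize a (t / b.T) := by
    exact_mod_cast h1
  have h2' : ((∑ i, ∑ j, delay (b.regular a) (t / b.s) i j : ℕ) : ℝ) ≤ n * b.k := by
    exact_mod_cast h2
  have h3' : ((∑ i, ∑ j, delay (b.kept a) (t / b.T) i j : ℕ) : ℝ) ≤ n * b.d := by
    exact_mod_cast h3
  have h7 : (∑ i, ∑ j, ((b.policy n).queue a t i j : ℝ)) =
      ((∑ i, ∑ j, (b.policy n).queue a t i j : ℕ) : ℝ) := by push_cast; rfl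
  rw [h7]
  linarith

end BatchParams

namespace IsBernoulliArrivals

variable {Ω : Type*} [MeasurableSpace Ω] {P : Measure Ω} {n : ℕ} {p : unitInterval}
  {a : ℕ → Ω → Fin n → Fin n → ℕ}

theorem integrable_arrival (h : IsBernoulliArrivals P p a) (t : ℕ) (i j : Fin n) :
    Integrable (fun ω => (a t ω i j : ℝ)) P :=
  h.integrable_comp (fun x => (x : ℝ)) t i j

theorem integrable_queue (h : IsBernoulliArrivals P p a) (π : SwitchPolicy n) (t : ℕ) :
    Integrable (fun ω => ∑ i, ∑ j, (π.queue (fun s => a s ω) t i j : ℝ)) P := by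
  refine integrable_finsetSum _ fun i _ => integrable_finsetSum _ fun j _ => ?_
  have hm := h.measurable_of_dependsOn (J := Finset.range t)
    (g := fun c => (π.queue c t i j : ℝ)) fun c c' hc => by
      simp only [SwitchPolicy.queue, π.state_congr fun r hr => hc r (Finset.mem_range.2 hr)]
  refine Integrable.mono' (g := fun ω => ∑ r ∈ Finset.range t, (a r ω i j : ℝ))
    (integrable_finsetSum _ fun r _ => h.integrable_arrival r i j) hm.aestronglyMeasurable
    (Filter.Eventually.of_forall fun ω => ?_)
  rw [Real.norm_of_nonneg (Nat.cast_nonneg _)]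
  exact_mod_cast π.queue_le_sum (fun s => a s ω) t i j

theorem integrable_frameSize (h : IsBernoulliArrivals P p a) (b : BatchParams) (v : ℕ) :
    Integrable (fun ω => (b.frameSize (fun t => a t ω) v : ℝ)) P := by
  simp only [BatchParams.frameSize, BatchParams.frame, Nat.cast_sum]
  exact integrable_finsetSum _ fun i _ => integrable_finsetSum _ fun j _ =>
    integrable_finsetSum _ fun t _ => h.integrable_arrival t i j

theorem integral_frameSize (h : IsBernoulliArrivals P p a) (b : BatchParams) (v : ℕ) :
    ∫ ω, (b.frameSize (fun t => a t ω) v : ℝ) ∂P = n * (n * (p : ℝ) * b.s) := by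
  simp only [BatchParams.frameSize, BatchParams.frame, Nat.cast_sum]
  rw [integral_finsetSum _ fun i _ => integrable_finsetSum _ fun j _ =>
    integrable_finsetSum _ fun t _ => h.integrable_arrival t i j]
  have h1 : ∀ i : Fin n, ∫ ω, ∑ j, ∑ t ∈ Finset.Ico (v * b.s) ((v + 1) * b.s),
      (a t ω i j : ℝ) ∂P = n * (p : ℝ) * b.s := by
    intro i
    rw [integral_finsetSum _ fun j _ =>
      integrable_finsetSum _ fun t _ => h.integrable_arrival t i j]
    have h2 : ∀ j : Fin n, ∫ ω, ∑ t ∈ Finset.Ico (v * b.s) ((v + 1) * b.s),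
        (a t ω i j : ℝ) ∂P = p * b.s := by
      intro j
      rw [integral_finsetSum _ fun t _ => h.integrable_arrival t i j]
      simp_rw [h.integral_eq]
      rw [Finset.sum_const, Nat.card_Ico, Nat.succ_mul, Nat.add_sub_cancel_left, nsmul_eq_mul,
        mul_comm]
    simp_rw [h2]
    simp [mul_assoc]
  simp_rw [h1]
  simp

open Classical in
theorem integrable_not_hasFactor [IsProbabilityMeasure P] (h : IsBernoulliArrivals P p a)
    (b : BatchParams) (v : ℕ) :
    Integrable (fun ω => if HasFactor b.k (b.frame (fun t => a t ω) v) then (0 : ℝ) else 1) P ∧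
      ∫ ω, (if HasFactor b.k (b.frame (fun t => a t ω) v) then (0 : ℝ) else 1) ∂P =
        P.real {ω | ¬ HasFactor b.k (b.frame (fun t => a t ω) v)} := by
  have hm := h.measurable_of_dependsOn (J := Finset.Ico (v * b.s) ((v + 1) * b.s))
    (g := fun c => if HasFactor b.k (b.frame c v) then (0 : ℝ) else 1) fun c c' hc => by
      rw [b.frame_congr hc]
  have hset : MeasurableSet {ω | ¬ HasFactor b.k (b.frame (fun t => a t ω) v)} := by
    convert hm (measurableSet_singleton 1) using 1
    ext ω
    simp
  have hind : (fun ω => if HasFactor b.k (b.frame (fun t => a t ω) v) then (0 : ℝ) else 1) =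
      {ω | ¬ HasFactor b.k (b.frame (fun t => a t ω) v)}.indicator fun _ => 1 := by
    ext ω
    simp [Set.indicator_apply]
  rw [hind]
  refine ⟨(integrable_const 1).indicator hset, ?_⟩
  rw [integral_indicator_const _ hset]
  simp

open Classical in
/-- The expected total queue size under the batching policy, in terms of the probability `pb` that
a frame has no `k`-factor and the probability `pf` that a batch overflows. -/
theorem integral_queue_policy_le [IsProbabilityMeasure P] (h : IsBernoulliArrivals P p a)
    (b : BatchParams) {pb pf : ℝ} (hn : 0 < n) (hk : b.k ≤ n * (p : ℝ) * b.s)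
    (hpb : ∀ v, P.real {ω | ¬ HasFactor b.k (b.frame (fun t => a t ω) v)} ≤ pb)
    (hpf : ∀ u, P.real {ω | b.Overflows (fun t => a t ω) u} ≤ pf)
    (hB : 8 * pf * (n * n * b.T) ≤ 1) (t : ℕ) :
    ∫ ω, ∑ i, ∑ j, ((b.policy n).queue (fun s => a s ω) t i j : ℝ) ∂P ≤
      n * (n * (p : ℝ) * b.s) + n * b.k +
        b.m * (n * (n * (p : ℝ) * b.s) - n * b.k + n * b.k * pb) + n * b.d +
        8 * pf * (n * n * b.T) ^ 2 := by
  have hterm : ∀ v, Integrable (fun ω => (b.frameSize (fun t => a t ω) v : ℝ) - n * b.k +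
      n * b.k * if HasFactor b.k (b.frame (fun t => a t ω) v) then 0 else 1) P := fun v =>
    ((h.integrable_frameSize b v).sub (integrable_const _)).add
      ((h.integrable_not_hasFactor b v).1.const_mul _)
  have hsum := integrable_finsetSum (Finset.Ico (t / b.T * b.m) (t / b.s)) fun v _ => hterm v
  have hback := h.integrable_backlogSize b (t / b.T) fun w => (w : ℝ)
  have hpb0 : 0 ≤ pb := measureReal_nonneg.trans (hpb 0)
  have hint : ∀ v, ∫ ω, ((b.frameSize (fun t => a t ω) v : ℝ) - n * b.k +
      n * b.k * if HasFactor b.k (b.frame (fun t => a t ω) v) then 0 else 1) ∂P ≤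
      n * (n * (p : ℝ) * b.s) - n * b.k + n * b.k * pb := by
    intro v
    have hsub : Integrable (fun ω => (b.frameSize (fun t => a t ω) v : ℝ) - n * b.k) P :=
      (h.integrable_frameSize b v).sub (integrable_const _)
    rw [integral_add hsub
      ((h.integrable_not_hasFactor b v).1.const_mul _),
      integral_sub (h.integrable_frameSize b v) (integrable_const _), h.integral_frameSize,
      integral_const, probReal_univ, one_smul, integral_const_mul,
      (h.integrable_not_hasFactor b v).2]
    have := mul_le_mul_of_nonneg_left (hpb v) (show (0 : ℝ) ≤ n * b.k by positivity)
    linarith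
  have hcard : (Finset.Ico (t / b.T * b.m) (t / b.s)).card ≤ b.m := by
    rw [Nat.card_Ico, b.div_T]
    have := Nat.lt_div_mul_add (a := t / b.s) b.m_pos
    omega
  -- The condition `k ≤ r` makes the bound per frame nonnegative, so the number of finished frames
  -- may be enlarged to `m`.
  have hterm0 : 0 ≤ n * (n * (p : ℝ) * b.s) - n * b.k + n * b.k * pb := by
    have h1 := mul_le_mul_of_nonneg_left hk (Nat.cast_nonneg (α := ℝ) n)
    have : (0 : ℝ) ≤ n * b.k * pb := by positivity
    linarith
  have hsumint : ∫ ω, ∑ v ∈ Finset.Ico (t / b.T * b.m) (t / b.s),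
      ((b.frameSize (fun t => a t ω) v : ℝ) - n * b.k +
      n * b.k * if HasFactor b.k (b.frame (fun t => a t ω) v) then 0 else 1) ∂P ≤
      b.m * (n * (n * (p : ℝ) * b.s) - n * b.k + n * b.k * pb) := by
    rw [integral_finsetSum _ fun v _ => hterm v]
    refine (Finset.sum_le_sum fun v _ => hint v).trans ?_
    rw [Finset.sum_const, nsmul_eq_mul]
    exact mul_le_mul_of_nonneg_right (by exact_mod_cast hcard) hterm0
  have h1 := (h.integrable_frameSize b (t / b.s)).add (integrable_const ((n : ℝ) * b.k))
  have h2 := h1.add hsum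
  have h3 := h2.add (integrable_const ((n : ℝ) * b.d))
  refine (integral_mono (h.integrable_queue _ t) (h3.add hback) fun ω =>
    b.sum_queue_policy_le (fun s => a s ω) t).trans ?_
  rw [integral_add' h3 hback, integral_add' h2 (integrable_const _), integral_add' h1 hsum,
    integral_add' (h.integrable_frameSize b (t / b.s)) (integrable_const _),
    h.integral_frameSize]
  have h4 := h.integral_backlogSize_le b hn hpf hB (t / b.T)
  simp only [integral_const, probReal_univ, one_smul]
  linarith

end IsBernoulliArrivals

/-! ### Tuning the parameters to the load. -/

namespace IsBernoulliArrivals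

variable {Ω : Type*} [MeasurableSpace Ω] {P : Measure Ω} {n : ℕ} {p : unitInterval}
  {a : ℕ → Ω → Fin n → Fin n → ℕ}

/-- The failure probabilities of the batching policy when its parameters are tuned to the load:
`x = (1 - ρ)⁻¹ᐟ³`, `s ≈ x⁴ L`, `m ≈ 140 x²`, and `k ≈ ρ s - 129 √(s L)`. -/
theorem failure_le [IsProbabilityMeasure P] (h : IsBernoulliArrivals P p a)
    (b : BatchParams) {x L N : ℝ} (hn : 2 ≤ n) (hx : 1 ≤ x) (hnN : n ≤ N) (hxN : x ^ 3 ≤ N)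
    (hL : Real.exp L = N) (hp : x ^ 3 * (1 - n * (p : ℝ)) = 1)
    (hs : x ^ 4 * L ≤ b.s) (hm : 140 * x ^ 2 ≤ b.m) (hm' : b.m ≤ 141 * x ^ 2)
    (hk : b.k = ⌊n * (p : ℝ) * b.s - 129 * √(b.s * L)⌋₊) :
    (∀ v, P.real {ω | ¬ HasFactor b.k (b.frame (fun t => a t ω) v)} ≤ 6 * N⁻¹ ^ 43) ∧
      ∀ u, P.real {ω | b.Overflows (fun t => a t ω) u} ≤ N⁻¹ ^ 31 := by
  have hnR : (2 : ℝ) ≤ n := by exact_mod_cast hn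
  have hN : 2 ≤ N := hnR.trans hnN
  have hN0 : 0 < N := by linarith
  have hL0 : 0 ≤ L := by
    rw [← Real.exp_le_exp, hL, Real.exp_zero]
    linarith
  have hs0 : (0 : ℝ) < b.s := by exact_mod_cast b.s_pos
  have hρ0 : 0 ≤ n * (p : ℝ) := mul_nonneg (by linarith) p.2.1
  have hρ1 : n * (p : ℝ) ≤ 1 := by
    by_contra hcon
    have := mul_nonneg (pow_nonneg (zero_le_one.trans hx) 3)
      (show 0 ≤ n * (p : ℝ) - 1 by linarith)
    linarith
  have hw : N⁻¹ = Real.exp (-L) := by rw [Real.exp_neg, hL]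
  have hw0 : 0 < N⁻¹ := inv_pos.2 hN0
  have hw2 : N⁻¹ ≤ 1 / 2 := by rw [one_div]; exact inv_anti₀ (by norm_num) hN
  have hNw : N * N⁻¹ = 1 := mul_inv_cancel₀ hN0.ne'
  have hwpow : ∀ j : ℕ, Real.exp (-(j * L)) = N⁻¹ ^ j := by
    intro j
    rw [hw, ← Real.exp_nat_mul]
    congr 1
    ring
  have hfac : ∀ v, P.real {ω | ¬ HasFactor b.k (b.frame (fun t => a t ω) v)} ≤
      6 * N⁻¹ ^ 43 := by
    intro v
    rcases Nat.eq_zero_or_pos b.k with hk0 | hk0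
    · rw [hk0]
      simp only [hasFactor_zero, not_true_eq_false]
      rw [show {ω : Ω | False} = ∅ from rfl, measureReal_empty]
      positivity
    · have hδ : b.k ≤ n * (p : ℝ) * b.s - 129 * √(b.s * L) := by
        have h1 := Nat.pos_of_floor_pos (hk ▸ hk0)
        have h2 := Nat.floor_le h1.le
        rwa [← hk] at h2
      set r : ℝ := n * (p : ℝ) * b.s with hr
      set δ : ℝ := 129 * √(b.s * L) with hδdef
      have hδ0 : 0 ≤ δ := by positivity
      have hδ2 : δ ^ 2 = 16641 * (b.s * L) := by
        rw [hδdef, mul_pow, Real.sq_sqrt (mul_nonneg hs0.le hL0)]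
        norm_num
      have hk1 : (1 : ℝ) ≤ b.k := by exact_mod_cast hk0
      have hrs : r ≤ b.s := by
        rw [hr]
        exact mul_le_of_le_one_left hs0.le hρ1
      have hr0 : 0 < r := by linarith
      -- A positive floor gives `δ ≤ r`, hence `129² s L = δ² ≤ r² ≤ r s`.
      have hrL : 16641 * L ≤ r := by
        have h1 : δ ^ 2 ≤ r ^ 2 := pow_le_pow_left₀ hδ0 (by linarith) 2
        rw [hδ2] at h1
        have h2 : r ^ 2 ≤ r * b.s := by
          rw [sq]; exact mul_le_mul_of_nonneg_left hrs hr0.le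
        have h3 : 16641 * L * b.s ≤ r * b.s := by linarith
        exact le_of_mul_le_mul_right h3 hs0
      have h43 : Real.exp (-(129 * L / 3)) = N⁻¹ ^ 43 := by
        rw [← hwpow]
        congr 1
        push_cast
        ring
      -- With `κ = 129 L`, the two conditions follow from `8 * 129 ≤ 129²` and `128 * 129 ≤ 129²`,
      -- and `κ / 3 = 43 L` gives the power `43`.
      have hmain := h.measure_not_hasFactor_le b v (κ := 129 * L) (by positivity) (by omega)
        hr0 (by linarith)
        (by
          have h1 : δ ^ 2 ≤ (r - b.k) ^ 2 := pow_le_pow_left₀ hδ0 (by linarith) 2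
          rw [hδ2] at h1
          have h2 := mul_le_mul_of_nonneg_left hrs hL0
          have h3 : 0 ≤ L * b.s := mul_nonneg hL0 hs0.le
          change 8 * (129 * L) * r ≤ (r - b.k) ^ 2
          linarith)
        (by
          change _ ≤ r
          linarith)
        (by
          rw [h43]
          calc (n : ℝ) * N⁻¹ ^ 43 ≤ N * N⁻¹ ^ 43 :=
                mul_le_mul_of_nonneg_right hnN (by positivity)
            _ = (N * N⁻¹) * N⁻¹ ^ 41 * N⁻¹ := by ring
            _ ≤ 1 * 1 * N⁻¹ := by
                rw [hNw]
                exact mul_le_mul_of_nonneg_right (mul_le_mul_of_nonneg_left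
                  (pow_le_one₀ hw0.le (by linarith)) zero_le_one) hw0.le
            _ ≤ 1 / 2 := by linarith)
      rwa [h43] at hmain
  refine ⟨hfac, fun u => ?_⟩
  refine (h.measure_overflows_le b u hρ1 hfac).trans ?_
  have hx2 : x ^ 2 ≤ N := (pow_le_pow_right₀ hx (by norm_num)).trans hxN
  -- Here `(1 - ρ)² T ≥ 140 L`, because `x ^ 6 (1 - ρ)² = 1`; division by `4` leaves `35 L`.
  have hT : Real.exp (-((1 - n * (p : ℝ)) ^ 2 * b.T / 4)) ≤ N⁻¹ ^ 35 := by
    rw [← hwpow, Real.exp_le_exp]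
    have h1 : 140 * x ^ 2 * (x ^ 4 * L) ≤ b.m * b.s :=
      mul_le_mul hm hs (by positivity) (Nat.cast_nonneg _)
    have h2 := mul_le_mul_of_nonneg_left h1 (sq_nonneg (1 - n * (p : ℝ)))
    have h3 : (1 - n * (p : ℝ)) ^ 2 * (140 * x ^ 2 * (x ^ 4 * L)) =
        140 * L * (x ^ 3 * (1 - n * (p : ℝ))) ^ 2 := by ring
    rw [h3, hp] at h2
    have h4 : (b.T : ℝ) = b.m * b.s := by simp [BatchParams.T]
    rw [h4]
    push_cast
    linarith
  have hpow10 : (1024 : ℝ) ≤ N ^ 10 := by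
    calc (1024 : ℝ) = 2 ^ 10 := by norm_num
      _ ≤ N ^ 10 := pow_le_pow_left₀ (by norm_num) hN 10
  have h1 : (b.m : ℝ) * (6 * N⁻¹ ^ 43) ≤ N⁻¹ ^ 32 := by
    calc (b.m : ℝ) * (6 * N⁻¹ ^ 43) = (b.m * 6) * N⁻¹ ^ 43 := by ring
      _ ≤ (N ^ 10 * N) * N⁻¹ ^ 43 := by
          refine mul_le_mul_of_nonneg_right ?_ (by positivity)
          calc (b.m : ℝ) * 6 ≤ 1024 * x ^ 2 := by nlinarith [sq_nonneg x]
            _ ≤ N ^ 10 * N := mul_le_mul hpow10 hx2 (sq_nonneg x) (by positivity)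
      _ = (N * N⁻¹) ^ 11 * N⁻¹ ^ 32 := by ring
      _ = _ := by rw [hNw]; ring
  have h2 : 2 * (n : ℝ) * Real.exp (-((1 - n * (p : ℝ)) ^ 2 * b.T / 4)) ≤ N⁻¹ ^ 32 := by
    calc 2 * (n : ℝ) * Real.exp (-((1 - n * (p : ℝ)) ^ 2 * b.T / 4))
        ≤ (N * N) * N⁻¹ ^ 35 :=
          mul_le_mul (mul_le_mul hN hnN (Nat.cast_nonneg _) hN0.le) hT (Real.exp_pos _).le
            (by positivity)
      _ = (N * N⁻¹) ^ 2 * (N⁻¹ ^ 32 * N⁻¹) := by ring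
      _ ≤ N⁻¹ ^ 32 := by
          rw [hNw, one_pow, one_mul]
          exact mul_le_of_le_one_right (by positivity) (by linarith)
  calc _ ≤ N⁻¹ ^ 32 + N⁻¹ ^ 32 := add_le_add h1 h2
    _ = N⁻¹ ^ 31 * (2 * N⁻¹) := by ring
    _ ≤ _ := mul_le_of_le_one_right (by positivity) (by linarith)

theorem integral_queue_tuned_policy_le [IsProbabilityMeasure P] (h : IsBernoulliArrivals P p a)
    (b : BatchParams) {x L N : ℝ} (hn : 2 ≤ n) (hx : 1 ≤ x) (hnN : n ≤ N) (hxN : x ^ 3 ≤ N)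
    (hL : Real.exp L = N) (hL2 : 1 / 2 ≤ L) (hp : x ^ 3 * (1 - n * (p : ℝ)) = 1)
    (hs : x ^ 4 * L ≤ b.s) (hs' : b.s ≤ 3 * (x ^ 4 * L))
    (hm : 140 * x ^ 2 ≤ b.m) (hm' : b.m ≤ 141 * x ^ 2)
    (hk : b.k = ⌊n * (p : ℝ) * b.s - 129 * √(b.s * L)⌋₊) (t : ℕ) :
    ∫ ω, ∑ i, ∑ j, ((b.policy n).queue (fun s => a s ω) t i j : ℝ) ∂P ≤
      100000 * n * x ^ 4 * L := by
  obtain ⟨hpb, hpf⟩ := h.failure_le b hn hx hnN hxN hL hp hs hm hm' hk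
  have hnR : (2 : ℝ) ≤ n := by exact_mod_cast hn
  have hN : 2 ≤ N := hnR.trans hnN
  have hN0 : 0 < N := by linarith
  have hL0 : 0 ≤ L := by linarith
  have hs0 : (0 : ℝ) < b.s := by exact_mod_cast b.s_pos
  have hρ0 : 0 ≤ n * (p : ℝ) := mul_nonneg (by linarith) p.2.1
  have hw0 : 0 < N⁻¹ := inv_pos.2 hN0
  have hw1 : N⁻¹ ≤ 1 := inv_le_one_of_one_le₀ (by linarith)
  have hNw : N * N⁻¹ = 1 := mul_inv_cancel₀ hN0.ne'
  set r : ℝ := n * (p : ℝ) * b.s with hr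
  set δ : ℝ := 129 * √(b.s * L) with hδdef
  set y : ℝ := x ^ 4 * L with hy
  have hx0 : 0 ≤ x := by linarith
  have hx4 : 1 ≤ x ^ 4 := one_le_pow₀ hx
  have hy2 : 1 ≤ 2 * y := by
    have := mul_le_mul hx4 hL2 (by norm_num) (by positivity)
    linarith
  have hr0 : 0 ≤ r := mul_nonneg hρ0 hs0.le
  have hδ0 : 0 ≤ δ := by positivity
  have hkr : b.k ≤ r := by
    rw [hk]
    rcases le_total 0 (r - δ) with h0 | h0
    · exact (Nat.floor_le h0).trans (by linarith)
    · rw [Nat.floor_of_nonpos h0]; simpa using hr0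
  have hrk : r - b.k ≤ δ + 1 := by
    have := Nat.lt_floor_add_one (r - δ)
    rw [← hk] at this
    linarith
  -- The slack of a frame, `(1 - ρ) s`, is of order `x L`, which is dominated by `δ`, of order `x ^
  -- 2 L`.
  have hεs : b.s - r ≤ 3 * (x * L) := by
    have h1 : (b.s : ℝ) - r = b.s * (1 - n * (p : ℝ)) := by rw [hr]; ring
    rw [h1]
    have h2 : 0 ≤ 1 - n * (p : ℝ) := by
      by_contra hcon
      have := mul_nonneg (pow_nonneg hx0 3) (show 0 ≤ -(1 - n * (p : ℝ)) by linarith)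
      linarith
    calc (b.s : ℝ) * (1 - n * (p : ℝ)) ≤ 3 * y * (1 - n * (p : ℝ)) :=
          mul_le_mul_of_nonneg_right hs' h2
      _ = 3 * (x * L) * (x ^ 3 * (1 - n * (p : ℝ))) := by rw [hy]; ring
      _ = _ := by rw [hp, mul_one]
  have hδ : δ ≤ 258 * (x ^ 2 * L) := by
    have : √(b.s * L) ≤ 2 * (x ^ 2 * L) := by
      rw [Real.sqrt_le_left (by positivity)]
      calc (b.s : ℝ) * L ≤ 3 * y * L := mul_le_mul_of_nonneg_right hs' hL0
        _ ≤ 4 * y * L := by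
            have : 0 ≤ y * L := by positivity
            linarith
        _ = _ := by rw [hy]; ring
    linarith
  have hx24 : x ^ 2 ≤ x ^ 4 := pow_le_pow_right₀ hx (by norm_num)
  -- The leading term: `m ≈ x ^ 2` frames lose about `x ^ 2 L` packets per line each.
  have hmδ : b.m * (δ + 1) ≤ 36660 * y := by
    have h1 : b.m * δ ≤ 141 * x ^ 2 * (258 * (x ^ 2 * L)) :=
      mul_le_mul hm' hδ hδ0 (by positivity)
    have h2 : x ^ 2 ≤ 2 * y := by
      have := mul_le_mul hx24 hL2 (by norm_num) (by positivity)
      linarith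
    have h3 : 141 * x ^ 2 * (258 * (x ^ 2 * L)) = 36378 * y := by rw [hy]; ring
    linarith
  have hmε : b.m * (b.s - r) ≤ 423 * y := by
    have h1 : b.m * (b.s - r) ≤ 141 * x ^ 2 * (3 * (x * L)) :=
      (mul_le_mul_of_nonneg_left hεs (Nat.cast_nonneg _)).trans
        (mul_le_mul_of_nonneg_right hm' (by positivity))
    have h2 : x ^ 3 * L ≤ y :=
      mul_le_mul_of_nonneg_right (pow_le_pow_right₀ hx (by norm_num)) hL0
    have h3 : 141 * x ^ 2 * (3 * (x * L)) = 423 * (x ^ 3 * L) := by ring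
    linarith
  have hTcast : (b.T : ℝ) = b.m * b.s := by simp [BatchParams.T]
  have hT : (b.T : ℝ) ≤ N ^ 12 := by
    have hLN : L ≤ N := by
      have := Real.add_one_le_exp L
      linarith
    have h1 : (b.m : ℝ) * b.s ≤ 141 * x ^ 2 * (3 * y) :=
      mul_le_mul hm' hs' hs0.le (by positivity)
    have h2 : 141 * x ^ 2 * (3 * y) = 423 * ((x ^ 3) ^ 2 * L) := by rw [hy]; ring
    have h3 : (x ^ 3) ^ 2 * L ≤ N ^ 2 * N :=
      mul_le_mul (pow_le_pow_left₀ (by positivity) hxN 2) hLN hL0 (by positivity)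
    have h4 : (512 : ℝ) ≤ N ^ 9 := by
      calc (512 : ℝ) = 2 ^ 9 := by norm_num
        _ ≤ N ^ 9 := pow_le_pow_left₀ (by norm_num) hN 9
    have h5 := mul_le_mul_of_nonneg_right h4 (show 0 ≤ N ^ 2 * N by positivity)
    rw [hTcast]
    calc (b.m : ℝ) * b.s ≤ 512 * (N ^ 2 * N) := by
          have : 0 ≤ N ^ 2 * N := by positivity
          linarith
      _ ≤ N ^ 9 * (N ^ 2 * N) := h5
      _ = N ^ 12 := by ring
  have hN3 : (8 : ℝ) ≤ N ^ 3 := by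
    calc (8 : ℝ) = 2 ^ 3 := by norm_num
      _ ≤ N ^ 3 := pow_le_pow_left₀ (by norm_num) hN 3
  have hB : (n : ℝ) * n * b.T ≤ N ^ 14 := by
    calc (n : ℝ) * n * b.T ≤ N * N * N ^ 12 :=
          mul_le_mul (mul_le_mul hnN hnN (by linarith) hN0.le) hT (Nat.cast_nonneg _)
            (by positivity)
      _ = _ := by ring
  -- The exponent `31 = 3 + 2 * 14` is just enough to bound the mean backlog by 1.
  have hBB : 8 * N⁻¹ ^ 31 * (n * n * b.T : ℝ) ^ 2 ≤ 1 := by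
    calc 8 * N⁻¹ ^ 31 * (n * n * b.T : ℝ) ^ 2 ≤ N ^ 3 * N⁻¹ ^ 31 * (N ^ 14) ^ 2 :=
          mul_le_mul (mul_le_mul_of_nonneg_right hN3 (by positivity))
            (pow_le_pow_left₀ (by positivity) hB 2) (by positivity) (by positivity)
      _ = (N * N⁻¹) ^ 31 := by ring
      _ = 1 := by rw [hNw, one_pow]
  have hB1 : (1 : ℝ) ≤ n * n * b.T := by
    exact_mod_cast Nat.mul_pos (Nat.mul_pos (by omega) (by omega)) b.T_pos
  have hB8 : 8 * N⁻¹ ^ 31 * (n * n * b.T : ℝ) ≤ 1 := by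
    refine le_trans (mul_le_mul_of_nonneg_left ?_ (by positivity)) hBB
    exact le_self_pow₀ hB1 (by norm_num)
  have hmain := h.integral_queue_policy_le b (by omega) hkr hpb hpf hB8 t
  refine hmain.trans ?_
  change n * r + n * b.k + b.m * (n * r - n * b.k + n * b.k * (6 * N⁻¹ ^ 43)) + n * b.d +
    8 * N⁻¹ ^ 31 * (n * n * b.T : ℝ) ^ 2 ≤ _
  have hrs : r ≤ b.s := by
    have h1 : x ^ 3 * (n * (p : ℝ)) ≤ x ^ 3 * 1 := by linarith
    exact mul_le_of_le_one_left hs0.le (le_of_mul_le_mul_left h1 (by positivity))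
  have hpart : b.m * (b.k * (6 * N⁻¹ ^ 43)) ≤ 1 := by
    calc b.m * (b.k * (6 * N⁻¹ ^ 43)) = b.m * b.k * 6 * N⁻¹ ^ 43 := by ring
      _ ≤ N ^ 12 * N ^ 3 * N⁻¹ ^ 43 := by
          refine mul_le_mul_of_nonneg_right (mul_le_mul ?_ (by linarith) (by norm_num)
            (by positivity)) (by positivity)
          refine le_trans ?_ hT
          rw [hTcast]
          exact mul_le_mul_of_nonneg_left (hkr.trans hrs) (Nat.cast_nonneg _)
      _ = (N * N⁻¹) ^ 15 * N⁻¹ ^ 28 := by ring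
      _ ≤ 1 := by
          rw [hNw, one_pow, one_mul]
          exact pow_le_one₀ hw0.le hw1
  have hd : (b.d : ℝ) ≤ b.m * (b.s - r) + b.m * (r - b.k) := by
    have h1 : b.d + b.m * b.k ≤ b.m * b.s := by
      have := b.d_add_one_add
      unfold BatchParams.T at this
      omega
    have h2 : (b.d : ℝ) + b.m * b.k ≤ b.m * b.s := by exact_mod_cast h1
    linarith
  have hmrk : b.m * (r - b.k) ≤ b.m * (δ + 1) :=
    mul_le_mul_of_nonneg_left hrk (Nat.cast_nonneg _)
  have hper : r + b.k + (b.m * (r - b.k) + b.m * (b.k * (6 * N⁻¹ ^ 43))) + b.d + 1 ≤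
      100000 * y := by
    linarith
  have hn0 : (0 : ℝ) ≤ n := by linarith
  have hfin := mul_le_mul_of_nonneg_left hper hn0
  calc n * r + n * b.k + b.m * (n * r - n * b.k + n * b.k * (6 * N⁻¹ ^ 43)) + n * b.d +
      8 * N⁻¹ ^ 31 * (n * n * b.T : ℝ) ^ 2
      ≤ n * r + n * b.k + b.m * (n * r - n * b.k + n * b.k * (6 * N⁻¹ ^ 43)) + n * b.d + n * 1 := by
        linarith
    _ = n * (r + b.k + (b.m * (r - b.k) + b.m * (b.k * (6 * N⁻¹ ^ 43))) + b.d + 1) := by ring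
    _ ≤ n * (100000 * y) := hfin
    _ = _ := by rw [hy]; ring

end IsBernoulliArrivals

/-- Rounding up costs only constants: `x ^ 4 * L ≥ 1 / 2` gives `⌈x ^ 4 * L⌉₊ ≤ 3 (x ^ 4 * L)`, and
`x ≥ 1` absorbs the rounding of `m`. -/
theorem exists_batchParams {ρ x L : ℝ} (hρ0 : 0 < ρ) (hρ1 : ρ < 1) (hx : 1 ≤ x) (hL2 : 1 / 2 ≤ L) :
    ∃ b : BatchParams, x ^ 4 * L ≤ b.s ∧ b.s ≤ 3 * (x ^ 4 * L) ∧ 140 * x ^ 2 ≤ b.m ∧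
      b.m ≤ 141 * x ^ 2 ∧ b.k = ⌊ρ * b.s - 129 * √(b.s * L)⌋₊ := by
  have hx2 : 1 ≤ x ^ 2 := one_le_pow₀ hx
  have hx4 : 1 ≤ x ^ 4 := one_le_pow₀ hx
  have hy2 : 1 / 2 ≤ x ^ 4 * L := by
    have := mul_le_mul hx4 hL2 (by norm_num) (by positivity)
    linarith
  have hs0 : 0 < ⌈x ^ 4 * L⌉₊ := Nat.ceil_pos.2 (by linarith)
  have hs0' : (0 : ℝ) < ⌈x ^ 4 * L⌉₊ := by exact_mod_cast hs0
  refine ⟨⟨⌊ρ * ⌈x ^ 4 * L⌉₊ - 129 * √(⌈x ^ 4 * L⌉₊ * L)⌋₊, ⌈x ^ 4 * L⌉₊, ⌈140 * x ^ 2⌉₊, ?_, ?_⟩,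
    Nat.le_ceil _, ?_, Nat.le_ceil _, ?_, rfl⟩
  · rw [Nat.floor_lt' hs0.ne']
    have h1 : 0 ≤ √(⌈x ^ 4 * L⌉₊ * L) := Real.sqrt_nonneg _
    have h2 := mul_lt_of_lt_one_left hs0' hρ1
    linarith
  · exact Nat.ceil_pos.2 (by positivity)
  · have := (Nat.ceil_lt_add_one (show 0 ≤ x ^ 4 * L by linarith)).le
    simp only
    linarith
  · have := (Nat.ceil_lt_add_one (show 0 ≤ 140 * x ^ 2 by positivity)).le
    simp only
    linarith

/-! ### The switch with one port, and the conclusion. -/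

/-- The policy that always serves every queue of a switch with one port. -/
def servePort : SwitchPolicy 1 :=
  ⟨fun _ _ => ⟨fun _ _ => 1, fun _ _ => Or.inr rfl, fun _ => by simp, fun _ => by simp⟩⟩

theorem queue_servePort_le {a : ℕ → Fin 1 → Fin 1 → ℕ} (ha : ∀ t i j, a t i j ≤ 1) (t : ℕ)
    (i j : Fin 1) : servePort.queue a t i j ≤ delay (fun s => a s i j) t := by
  have hle : ∀ t, servePort.queue a t i j ≤ 1 ∧
      servePort.queue a (t + 1) i j = (servePort.queue a t i j - 1) + a t i j := by
    intro t
    refine ⟨?_, rfl⟩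
    induction t with
    | zero => exact Nat.zero_le _
    | succ t ih =>
      have h1 : servePort.queue a (t + 1) i j = (servePort.queue a t i j - 1) + a t i j := rfl
      have := ha t i j
      omega
  cases t with
  | zero => exact le_rfl
  | succ t =>
    have := hle t
    simp only [delay]
    omega

theorem theorem1 :
    ∃ c : ℝ, 0 < c ∧
      ∀ (n : ℕ) (ρ : ℝ), 1 ≤ n → 0 < ρ → ρ < 1 →
        ∃ π : SwitchPolicy n,
          ∀ (Ω : Type*) [MeasurableSpace Ω] (P : Measure Ω) [IsProbabilityMeasure P]
            (p : unitInterval) (a : ℕ → Ω → Fin n → Fin n → ℕ),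
            (p : ℝ) = ρ / n → IsBernoulliArrivals P p a →
            ∀ t : ℕ,
              Integrable (fun ω => ∑ i, ∑ j, (π.queue (fun s => a s ω) t i j : ℝ)) P ∧
              ∫ ω, ∑ i, ∑ j, (π.queue (fun s => a s ω) t i j : ℝ) ∂P ≤
                c * n * (1 - ρ) ^ (-(4 / 3) : ℝ) * Real.log (max (n : ℝ) (1 / (1 - ρ))) := by
  refine ⟨100000, by norm_num, fun n ρ hn hρ0 hρ1 => ?_⟩
  have hε0 : 0 < 1 - ρ := by linarith
  set x : ℝ := (1 - ρ) ^ (-(1 / 3) : ℝ) with hxdef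
  have hx : 1 ≤ x := Real.one_le_rpow_of_pos_of_le_one_of_nonpos hε0 (by linarith) (by norm_num)
  have hx4 : (1 - ρ) ^ (-(4 / 3) : ℝ) = x ^ 4 := by
    rw [hxdef, ← Real.rpow_natCast, ← Real.rpow_mul hε0.le]
    norm_num
  have hx3 : x ^ 3 = 1 / (1 - ρ) := by
    rw [hxdef, ← Real.rpow_natCast, ← Real.rpow_mul hε0.le, one_div (1 - ρ),
      show (-(1 / 3) : ℝ) * ((3 : ℕ) : ℝ) = -1 by norm_num, Real.rpow_neg_one]
  rw [hx4]
  have hx4' : 1 ≤ x ^ 4 := one_le_pow₀ hx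
  -- For `n = 1` the logarithm tends to `0` with `ρ`, so a bound linear in `ρ` is needed: serving
  -- always leaves at most the last arrival, of mean `ρ ≤ log (1 / (1 - ρ))`. For `n ≥ 2` the
  -- logarithm is at least `log 2 > 1 / 2`.
  rcases hn.eq_or_lt with rfl | hn2
  · refine ⟨servePort, fun Ω _ P _ p a hp h t => ⟨h.integrable_queue _ t, ?_⟩⟩
    have hlog : ρ ≤ Real.log (max ((1 : ℕ) : ℝ) (1 / (1 - ρ))) := by
      have h1 : (1 : ℝ) ≤ 1 / (1 - ρ) := by rw [← hx3]; exact one_le_pow₀ hx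
      rw [Nat.cast_one, max_eq_right h1, one_div, Real.log_inv]
      have := Real.log_le_sub_one_of_pos hε0
      linarith
    have hq : ∫ ω, ∑ i, ∑ j, (servePort.queue (fun s => a s ω) t i j : ℝ) ∂P ≤ ρ := by
      simp only [Fin.sum_univ_one]
      cases t with
      | zero => simpa [SwitchPolicy.queue, SwitchPolicy.state] using hρ0.le
      | succ t =>
        have h1 : ∫ ω, (a t ω 0 0 : ℝ) ∂P = ρ := by rw [h.integral_eq, hp]; simp
        rw [← h1]
        refine integral_mono_ae ?_ (h.integrable_arrival t 0 0) ?_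
        · simpa using h.integrable_queue servePort (t + 1)
        · filter_upwards [h.ae_le_one] with ω hω
          exact_mod_cast queue_servePort_le (a := fun s => a s ω) hω (t + 1) 0 0
    refine hq.trans ?_
    have h2 : (1 : ℝ) ≤ 100000 * ((1 : ℕ) : ℝ) * x ^ 4 := by
      push_cast
      linarith
    exact hlog.trans (le_mul_of_one_le_left (hρ0.le.trans hlog) h2)
  · have hnR : (2 : ℝ) ≤ n := by exact_mod_cast hn2
    set N : ℝ := max (n : ℝ) (1 / (1 - ρ))
    have hnN : (n : ℝ) ≤ N := le_max_left _ _
    have hN0 : 0 < N := by linarith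
    have hL2 : 1 / 2 ≤ Real.log N := by
      have h1 := Real.log_le_log (by norm_num) (hnR.trans hnN)
      have := Real.log_two_gt_d9
      linarith
    obtain ⟨b, hs, hs', hm, hm', hk⟩ := exists_batchParams hρ0 hρ1 hx hL2
    refine ⟨b.policy n, fun Ω _ P _ p a hp h t => ⟨h.integrable_queue _ t, ?_⟩⟩
    have hnp : n * (p : ℝ) = ρ := by
      rw [hp]
      field_simp
    refine h.integral_queue_tuned_policy_le b hn2 hx hnN (hx3 ▸ le_max_right _ _)
      (Real.exp_log hN0) hL2 ?_ hs hs' hm hm' (by rw [hnp]; exact hk) t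
    rw [hnp, hx3]
    field_simp
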